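/- **Notation.** $p,q,q_1,q_2$ denote primes, $M,N$ integers. For $\varepsilon>0$ and $N\ge 2$ let $\mathcal P_{\varepsilon,N}$ be the set of primes in $[\exp((\log N)^{\varepsilon}),\exp((\log N)^{1-\varepsilon})]$. The sum $\sum_{pq\le N}$ runs over ordered pairs of primes $(p,q)$ with $pq\le N$. **(1)** For every $K>0$ there is a constant $C=C(K)>0$, depending only on $K$, such that the following holds. Let $\varepsilon>0$, let $(a_n)$ be a sequence of complex numbers with $|a_n|\le 1$, and let $N\ge 2$ satisfy $\exp((\log N)^{\varepsilon})>(\log N)^{1000}$. Suppose that for every integer $M\ge 2$ with $N^{9/10}\le M\le N$ there is given a subset $\mathcal S_{\varepsilon,M}\subseteq\mathcal P_{\varepsilon,M}$ such that for every real $P\ge1$ at most $K P/(\log M)^{100}$ elements of $\mathcal P_{\varepsilon,M}\cap[P,2P]$ do not belong to $\mathcal S_{\varepsilon,M}$, and such that $$\Big|\sum_{n\le M}a_{nq_1}\overline{a_{nq_2}}\Big|\le K\,\frac{M}{(\log M)^{100}}$$ for all $q_1\ne q_2$ in $\mathcal S_{\varepsilon,M}$ with $1/5\le q_1/q_2\le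 5$. Then $$\Big|\sum_{pq\le N}a_{pq}\Big|\le C\Big(\varepsilon\sum_{pq\le N}1+\frac1{\varepsilon^{53}}\cdot\frac{N}{(\log N)^{50}}\Big).$$ (In particular this holds, with the same $C$, for every such $N$ if the hypotheses on $M$ hold for all $M\ge 2$.) **(2)** For every $K>0$ there are $C>0$ and $N_0$, depending only on $K$, such that the following holds. Let $(a_n)$ be a sequence of complex numbers with $|a_n|\le 1$ and let $N\ge N_0$. Suppose that for every integer $M\in[N^{9/10},N]$ $$\Big|\sum_{n\le M}a_{nq_1}\overline{a_{nq_2}}\Big|\le K\,\frac{M}{(\log\log M)^{10}}$$ for all primes $q_1\neq q_2$ in $\big[e^{(\log\log\log N)^3},e^{(\log\log N)^{10}}\big]$ with $1/5\le q_1/q_2\le5$. Then for every multiplicative function $\nu:\mathbb N\to\mathbb C$ with $|\nu|\le1$, $$\Big|\sum_{n\le N}\nu(n)a_n\Big|\le C\,N(\log\log N)^{-4}.$$ -/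

import Mathlib

noncomputable section

namespace SemiprimeCriterion

/-- The primes in the interval `[exp((log N)^ε), exp((log N)^(1-ε))]`. -/
def primeWindow (ε : ℝ) (N : ℕ) : Set ℕ :=
  {q : ℕ | q.Prime ∧ Real.exp (Real.log N ^ ε) ≤ q ∧ (q : ℝ) ≤ Real.exp (Real.log N ^ (1 - ε))}

/-- The ordered pairs of primes `(p, q)` with `p * q ≤ N`. -/
def primePairs (N : ℕ) : Finset (ℕ × ℕ) :=
  (Finset.range (N + 1) ×ˢ Finset.range (N + 1)).filter
    fun r => r.1.Prime ∧ r.2.Prime ∧ r.1 * r.2 ≤ N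

/-- The bilinear sum `∑_{n ≤ M} a (n q₁) * conj (a (n q₂))`. -/
def bilinearSum (a : ℕ → ℂ) (q₁ q₂ M : ℕ) : ℂ :=
  ∑ n ∈ Finset.Icc 1 M, a (n * q₁) * starRingEnd ℂ (a (n * q₂))

/-- Two distinct positive integers whose ratio lies between `1/5` and `5`. -/
def Comparable (q₁ q₂ : ℕ) : Prop :=
  q₁ ≠ q₂ ∧ (1 / 5 : ℝ) ≤ (q₁ : ℝ) / q₂ ∧ (q₁ : ℝ) / q₂ ≤ 5

/-- `S` consists of most primes of the window: in every interval `[P, 2P]` at most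
`K * P / (log M)^100` primes of the window are missing from `S`. -/
def MostPrimes (K ε : ℝ) (M : ℕ) (S : Set ℕ) : Prop :=
  S ⊆ primeWindow ε M ∧
  ∀ P : ℝ, 1 ≤ P →
    (({q : ℕ | q ∈ primeWindow ε M ∧ q ∉ S ∧ P ≤ q ∧ (q : ℝ) ≤ 2 * P}.ncard : ℕ) : ℝ)
      ≤ K * (P / Real.log M ^ 100)

/-- The bilinear bound of length `M`, with constant `K`, for comparable distinct members of `S`. -/
def StrongBilinearBound (K : ℝ) (a : ℕ → ℂ) (M : ℕ) (S : Set ℕ) : Prop :=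
  ∀ q₁ ∈ S, ∀ q₂ ∈ S, Comparable q₁ q₂ →
    ‖bilinearSum a q₁ q₂ M‖ ≤ K * (M / Real.log M ^ 100)

/-- The doubly logarithmic bilinear bound at scale `N`, with constant `K`: it is required for all
lengths `M ∈ [N^(9/10), N]` and all comparable distinct primes in
`[exp((log log log N)^3), exp((log log N)^10)]`. -/
def WeakBilinearBound (K : ℝ) (a : ℕ → ℂ) (N : ℕ) : Prop :=
  ∀ M : ℕ, (N : ℝ) ^ (9 / 10 : ℝ) ≤ M → M ≤ N →
    ∀ q₁ q₂ : ℕ, q₁.Prime → q₂.Prime →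
      Real.exp (Real.log (Real.log (Real.log N)) ^ 3) ≤ q₁ →
      (q₁ : ℝ) ≤ Real.exp (Real.log (Real.log N) ^ 10) →
      Real.exp (Real.log (Real.log (Real.log N)) ^ 3) ≤ q₂ →
      (q₂ : ℝ) ≤ Real.exp (Real.log (Real.log N) ^ 10) →
      Comparable q₁ q₂ →
      ‖bilinearSum a q₁ q₂ M‖ ≤ K * (M / Real.log (Real.log M) ^ 10)

end SemiprimeCriterion

end

noncomputable section

namespace SemiprimeCriterion

open Finset

/-! ### Elementary estimates for primes -/

/-! Both parts follow the Kátai / Bourgain–Sarnak–Ziegler method. In a sum of `b q * c m * a (m *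
q)`, split `q` into geometric blocks `[lam ^ j, lam ^ (j + 1))` with `lam = 1 + δ`. In one block the
condition `m * q ≤ N` is replaced by `m ≤ N / lam ^ j`, the same for every `q`; this only adds
products in `(N, lam * N]`, about `δ * N` integers. Cauchy–Schwarz in `m` then leaves the
correlations `bilinearSum a q₁ q₂ M`: the diagonal costs `N / √X` for a block at height `X`, and the
off-diagonal terms gain the square root of the assumed saving (`norm_sum_sum_sq_le`,
`norm_block_le`, `norm_sum_blocks_le`).

For pairs of primes, call `q` core if it lies in the window with its upper exponent halved.
Inclusion–exclusion reduces the sum to pairs with one core member. Pairs with both members core are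
negligible by size; pairs with none have their smaller member at most `√N` and outside the core, so
Mertens' bounds make them a proportion `O(ε)` of all pairs, once the total is bounded below by
`le_card_primePairs`. For one core member, `norm_sum_core_le` uses blocks with `δ = (log N) ^
(-50)`. The cofactors are primes, and their density `O(1 / log N)` gives a factor `(log N) ^ (-1/2)`
that absorbs the `log log N` coming from the sum of `1 / q`.

For a multiplicative weight, put `l = log log N` and let `W` be the primes of the doubly logarithmic
window. Most `n` factor uniquely as `m * p`, with `p` in the lowest block of `W` meeting `n` and `m`
free of primes of `W` up to that block. Then `m` and `p` are coprime, `ν` splits, and the block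
estimate applies. The exceptions are the `n` free of `W`, controlled by the sieve
`card_freeOf_mul_log_mul_log_le`, and the `n` with two prime factors in one block, which are rare
because blocks are short. -/

/-- Any finite set of primes up to `n` satisfies Mertens' first upper bound. -/
lemma sum_log_div_prime_le {n : ℕ} (hn : 1 ≤ n) {F : Finset ℕ}
    (hF : ∀ p ∈ F, p.Prime ∧ p ≤ n) :
    ∑ p ∈ F, Real.log p / p ≤ Real.log n + Real.log 4 := by
  have hn' : (0 : ℝ) < n := by exact_mod_cast hn
  have hsub : F ⊆ n.primesLE := fun p hp => Nat.mem_primesLE.2 ⟨(hF p hp).2, (hF p hp).1⟩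
  -- The left side is `log n!`, because `Λ * 1 = log`. Replacing `⌊n / p⌋` by `n / p` later costs
  -- `θ(n) ≤ n * log 4`.
  have h1 : ∑ d ∈ Ioc 0 n, ArithmeticFunction.vonMangoldt d * ((n / d : ℕ) : ℝ)
      ≤ n * Real.log n := by
    have := ArithmeticFunction.sum_Ioc_mul_zeta_eq_sum ArithmeticFunction.vonMangoldt n
    rw [← this, ArithmeticFunction.vonMangoldt_mul_zeta]
    calc ∑ m ∈ Ioc 0 n, ArithmeticFunction.log m ≤ ∑ m ∈ Ioc 0 n, Real.log n := by
          refine sum_le_sum fun m hm => ?_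
          simp only [mem_Ioc] at hm
          rw [ArithmeticFunction.log_apply]
          exact Real.log_le_log (by exact_mod_cast hm.1) (by exact_mod_cast hm.2)
      _ = n * Real.log n := by simp
  have h2 : ∑ p ∈ n.primesLE, Real.log p * ((n / p : ℕ) : ℝ)
      ≤ ∑ d ∈ Ioc 0 n, ArithmeticFunction.vonMangoldt d * ((n / d : ℕ) : ℝ) := by
    calc _ = ∑ p ∈ n.primesLE, ArithmeticFunction.vonMangoldt p * ((n / p : ℕ) : ℝ) := by
          refine sum_congr rfl fun p hp => ?_
          rw [ArithmeticFunction.vonMangoldt_apply_prime (Nat.prime_of_mem_primesLE hp)]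
      _ ≤ _ := by
          refine sum_le_sum_of_subset_of_nonneg (fun p hp => ?_) fun d _ _ =>
            mul_nonneg ArithmeticFunction.vonMangoldt_nonneg (Nat.cast_nonneg _)
          have := Nat.mem_primesLE.1 hp
          exact mem_Ioc.2 ⟨this.2.pos, this.1⟩
  have h3 : ∑ p ∈ n.primesLE, Real.log p ≤ Real.log 4 * n := by
    rw [← Chebyshev.theta_eq_sum_primesLE_log]
    exact Chebyshev.theta_le_log4_mul_x hn'.le
  have h4 : n * ∑ p ∈ n.primesLE, Real.log p / p ≤ n * (Real.log n + Real.log 4) := by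
    calc n * ∑ p ∈ n.primesLE, Real.log p / p
        = ∑ p ∈ n.primesLE, Real.log p * (n / p : ℝ) := by
          rw [mul_sum]; exact sum_congr rfl fun p _ => by ring
      _ ≤ ∑ p ∈ n.primesLE, (Real.log p * ((n / p : ℕ) : ℝ) + Real.log p) := by
          refine sum_le_sum fun p hp => ?_
          have hp0 : 0 ≤ Real.log p := Real.log_natCast_nonneg p
          have : (n / p : ℝ) ≤ ((n / p : ℕ) : ℝ) + 1 := by
            rw [← Nat.floor_div_eq_div (K := ℝ)]; exact (Nat.lt_floor_add_one _).le
          nlinarith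
      _ ≤ n * Real.log n + Real.log 4 * n := by
          rw [sum_add_distrib]; linarith
      _ = _ := by ring
  calc _ ≤ ∑ p ∈ n.primesLE, Real.log p / p :=
        sum_le_sum_of_subset_of_nonneg hsub fun p _ _ =>
          div_nonneg (Real.log_natCast_nonneg p) (Nat.cast_nonneg _)
    _ ≤ _ := le_of_mul_le_mul_left h4 hn'

/-- On `[y, y ^ 2]` the weight `log p` is at least `log y`, while Mertens' first bound gives at most
`2 * log y + 2 * log 2 ≤ 4 * log y`. -/
lemma sum_inv_prime_sq_le {y : ℝ} (hy : 2 ≤ y) {F : Finset ℕ}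
    (hF : ∀ p ∈ F, p.Prime ∧ y ≤ p ∧ (p : ℝ) ≤ y ^ 2) : ∑ p ∈ F, (1 : ℝ) / p ≤ 4 := by
  have hl2 : 0 < Real.log 2 := Real.log_pos (by norm_num)
  have hly : Real.log 2 ≤ Real.log y := Real.log_le_log (by norm_num) hy
  have hy1 : (1 : ℝ) ≤ y ^ 2 := by nlinarith
  have h := sum_log_div_prime_le (n := ⌊y ^ 2⌋₊) (F := F) (Nat.one_le_floor_iff _ |>.2 hy1)
    fun p hp => ⟨(hF p hp).1, Nat.le_floor (hF p hp).2.2⟩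
  have h1 : Real.log ⌊y ^ 2⌋₊ ≤ 2 * Real.log y := by
    rw [show 2 * Real.log y = Real.log (y ^ 2) by rw [Real.log_pow]; norm_num]
    exact Real.log_le_log (by exact_mod_cast Nat.one_le_floor_iff _ |>.2 hy1)
      (Nat.floor_le (by positivity))
  have h2 : Real.log y * ∑ p ∈ F, (1 : ℝ) / p ≤ ∑ p ∈ F, Real.log p / p := by
    rw [mul_sum]
    refine sum_le_sum fun p hp => ?_
    rw [mul_one_div]
    have : Real.log y ≤ Real.log p := Real.log_le_log (by linarith) (hF p hp).2.1
    gcongr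
  have h3 : Real.log 4 = 2 * Real.log 2 := by
    rw [show (4 : ℝ) = 2 ^ 2 by norm_num, Real.log_pow]; norm_num
  have : Real.log y * ∑ p ∈ F, (1 : ℝ) / p ≤ Real.log y * 4 := by linarith
  exact le_of_mul_le_mul_left this (by linarith)

/-- Repeated squaring cuts the range into intervals `[z, z ^ 2]`, each contributing at most 4. -/
lemma sum_inv_prime_pow_two_pow_le {y : ℝ} (hy : 2 ≤ y) (k : ℕ) : ∀ {F : Finset ℕ},
    (∀ p ∈ F, p.Prime ∧ y ≤ p ∧ (p : ℝ) ≤ y ^ 2 ^ k) → ∑ p ∈ F, (1 : ℝ) / p ≤ 4 * (k + 1) := by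
  induction k with
  | zero =>
    intro F hF
    have := sum_inv_prime_sq_le hy (F := F) fun p hp => ⟨(hF p hp).1, (hF p hp).2.1, by
      have := (hF p hp).2.2; simp at this; nlinarith⟩
    simpa using this
  | succ k ih =>
    intro F hF
    rw [← sum_filter_add_sum_filter_not F (fun p : ℕ => (p : ℝ) ≤ y ^ 2 ^ k)]
    have h1 := ih (F := F.filter (fun p : ℕ => (p : ℝ) ≤ y ^ 2 ^ k)) fun p hp => by
      rw [mem_filter] at hp
      exact ⟨(hF p hp.1).1, (hF p hp.1).2.1, hp.2⟩
    have hy2 : 2 ≤ y ^ 2 ^ k := hy.trans (le_self_pow₀ (by linarith) (by positivity))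
    have h2 := sum_inv_prime_sq_le hy2 (F := F.filter (fun p : ℕ => ¬ (p : ℝ) ≤ y ^ 2 ^ k))
      fun p hp => by
        rw [mem_filter] at hp
        refine ⟨(hF p hp.1).1, (not_le.1 hp.2).le, ?_⟩
        rw [← pow_mul, ← pow_succ]; exact (hF p hp.1).2.2
    push_cast; linarith

/-- Mertens' second upper bound, up to constants, for primes in `[y, z]`. -/
lemma sum_inv_prime_le {y z : ℝ} (hy : 2 ≤ y) (hyz : y ≤ z) {F : Finset ℕ}
    (hF : ∀ p ∈ F, p.Prime ∧ y ≤ p ∧ (p : ℝ) ≤ z) :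
    ∑ p ∈ F, (1 : ℝ) / p ≤ 6 * Real.log (Real.log z / Real.log y) + 8 := by
  have hly : 0 < Real.log y := Real.log_pos (by linarith)
  have hlz : Real.log y ≤ Real.log z := Real.log_le_log (by linarith) hyz
  set r := Real.log z / Real.log y with hr
  have hr1 : 1 ≤ r := by rw [hr, le_div_iff₀ hly]; linarith
  have hl2 : 0.6931471803 < Real.log 2 := Real.log_two_gt_d9
  have hlr : 0 ≤ Real.log r := Real.log_nonneg hr1
  -- The number of squarings needed to pass from `y` to `z`. Since `1 / log 2 ≤ 1.5`, the bound `4 *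
  -- (k + 1)` is at most `6 * log r + 8`.
  set k := ⌈Real.log r / Real.log 2⌉₊ with hk
  have hk1 : Real.log r / Real.log 2 ≤ k := Nat.le_ceil _
  have hk2 : (k : ℝ) < Real.log r / Real.log 2 + 1 :=
    Nat.ceil_lt_add_one (div_nonneg hlr (by linarith))
  have hrk : r ≤ 2 ^ k := by
    rw [← Real.log_le_log_iff (by linarith) (by positivity), Real.log_pow]
    rwa [div_le_iff₀ (by linarith)] at hk1
  have hz : z ≤ y ^ 2 ^ k := by
    rw [← Real.log_le_log_iff (by linarith) (by positivity), Real.log_pow]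
    rw [hr, div_le_iff₀ hly] at hrk
    exact_mod_cast hrk
  have := sum_inv_prime_pow_two_pow_le hy k (F := F) fun p hp =>
    ⟨(hF p hp).1, (hF p hp).2.1, (hF p hp).2.2.trans hz⟩
  have h5 : Real.log r / Real.log 2 ≤ 1.5 * Real.log r := by
    rw [div_le_iff₀ (by linarith)]
    nlinarith
  linarith

lemma sum_inv_prime_le_log_log {z : ℝ} (hz : 2 ≤ z) {F : Finset ℕ}
    (hF : ∀ p ∈ F, p.Prime ∧ (p : ℝ) ≤ z) :
    ∑ p ∈ F, (1 : ℝ) / p ≤ 6 * Real.log (Real.log z) + 14 := by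
  have h := sum_inv_prime_le le_rfl hz (F := F) fun p hp =>
    ⟨(hF p hp).1, by exact_mod_cast (hF p hp).1.two_le, (hF p hp).2⟩
  have hl2 : 0.6931471803 < Real.log 2 := Real.log_two_gt_d9
  have hlz : Real.log 2 ≤ Real.log z := Real.log_le_log (by linarith) hz
  rw [Real.log_div (by linarith) (by linarith)] at h
  have := Real.one_sub_inv_le_log_of_pos (x := Real.log 2) (by linarith)
  have h2 : (Real.log 2)⁻¹ ≤ 2 := by
    rw [inv_le_comm₀ (by linarith) (by norm_num)]; linarith
  linarith

/-- Reciprocals of integers composed of primes of `s` are controlled by the Euler product. -/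
lemma sum_inv_le_exp_of_primeFactors_subset {s F : Finset ℕ} (hs : ∀ p ∈ s, p.Prime)
    (hF : ∀ n ∈ F, n ≠ 0 ∧ ∀ p : ℕ, p.Prime → p ∣ n → p ∈ s) :
    ∑ n ∈ F, (1 : ℝ) / n ≤ Real.exp (2 * ∑ p ∈ s, (1 : ℝ) / p) := by
  classical
  let f : ℕ →* ℝ :=
    { toFun := fun n => (n : ℝ)⁻¹
      map_one' := by simp
      map_mul' := fun m n => by simp [mul_comm] }
  have hf : ∀ {p : ℕ}, p.Prime → ‖f p‖ < 1 := fun {p} hp => by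
    have : (1 : ℝ) < p := by exact_mod_cast hp.one_lt
    simpa [f] using inv_lt_one_of_one_lt₀ this
  obtain ⟨h1, h2⟩ :=
    EulerProduct.summable_and_hasSum_factoredNumbers_prod_filter_prime_geometric hf s
  have hmem : ∀ n ∈ F, n ∈ Nat.factoredNumbers s := fun n hn => by
    rw [Nat.mem_factoredNumbers']
    exact (hF n hn).2
  have h3 : ∑ n ∈ F, (1 : ℝ) / n ≤ ∏ p ∈ s with p.Prime, (1 - f p)⁻¹ := by
    rw [← h2.tsum_eq]
    have := h2.summable.sum_le_tsum (F.subtype (· ∈ Nat.factoredNumbers s))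
      fun n _ => inv_nonneg.2 (Nat.cast_nonneg _)
    rw [sum_subtype_of_mem (fun n : ℕ => f n) hmem] at this
    simpa [f] using this
  refine h3.trans ?_
  rw [filter_true_of_mem hs, mul_sum, Real.exp_sum]
  refine prod_le_prod (fun p hp => ?_) fun p hp => ?_
  · have := hf (hs p hp)
    rw [Real.norm_eq_abs, abs_lt] at this
    exact inv_nonneg.2 (by linarith)
  · have hp2 : (2 : ℝ) ≤ p := by exact_mod_cast (hs p hp).two_le
    have hx : (p : ℝ)⁻¹ ≤ 1 / 2 := by rw [← one_div]; gcongr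
    change (1 - (p : ℝ)⁻¹)⁻¹ ≤ _
    rw [one_div]
    set x := (p : ℝ)⁻¹
    have hx0 : 0 ≤ x := by positivity
    calc (1 - x)⁻¹ ≤ 2 * x + 1 := by
          rw [inv_le_iff_one_le_mul₀ (by linarith)]; nlinarith
      _ ≤ Real.exp (2 * x) := Real.add_one_le_exp _

lemma sum_one_div_Icc_le (n : ℕ) : ∑ i ∈ Icc 1 n, (1 : ℝ) / i ≤ 1 + Real.log n := by
  have := harmonic_le_one_add_log n
  rw [harmonic_eq_sum_Icc] at this
  push_cast at this
  simpa using this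

lemma log_le_sum_one_div_Icc {n : ℕ} (hn : 1 ≤ n) :
    Real.log n ≤ ∑ i ∈ Icc 1 n, (1 : ℝ) / i := by
  have := log_add_one_le_harmonic n
  rw [harmonic_eq_sum_Icc] at this
  push_cast at this
  have h2 : Real.log n ≤ Real.log (n + 1) :=
    Real.log_le_log (by exact_mod_cast hn) (by linarith)
  simpa using h2.trans this

/-- Every integer up to `n` is composed of primes up to `n`, so the harmonic sum is below the Euler
product bound. -/
lemma log_log_le_sum_inv_prime {n : ℕ} (hn : 2 ≤ n) :
    Real.log (Real.log n) ≤ 2 * ∑ p ∈ n.primesLE, (1 : ℝ) / p := by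
  have h0 : 0 < Real.log n := Real.log_pos (by exact_mod_cast hn)
  rw [Real.log_le_iff_le_exp h0]
  refine (log_le_sum_one_div_Icc (by omega)).trans ?_
  refine sum_inv_le_exp_of_primeFactors_subset (fun p hp => Nat.prime_of_mem_primesLE hp) ?_
  intro m hm
  simp only [mem_Icc] at hm
  exact ⟨by omega, fun p hp hpm => Nat.mem_primesLE.2 ⟨(Nat.le_of_dvd (by omega) hpm).trans hm.2, hp⟩⟩

lemma card_primesLE_mul_log_le {x : ℝ} (hx : 1 < x) :
    ((⌊x⌋₊.primesLE.card : ℕ) : ℝ) * Real.log x ≤ 5 * x := by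
  have h := Chebyshev.pi_le_log4_mul_div hx
  rw [Nat.primesLE_card_eq_primeCounting]
  have hlx : 0 < Real.log x := Real.log_pos hx
  rw [Real.log_sqrt (by linarith)] at h
  have hs : Real.log x ≤ 2 * √x := by
    have := Real.log_le_self (x := √x) (by positivity)
    rw [Real.log_sqrt (by linarith)] at this
    linarith
  have h4 : Real.log 4 = 2 * Real.log 2 := by
    rw [show (4 : ℝ) = 2 ^ 2 by norm_num, Real.log_pow]; norm_num
  have hl2 := Real.log_two_lt_d9
  calc _ ≤ (Real.log 4 * x / (Real.log x / 2) + √x) * Real.log x := by gcongr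
    _ = 2 * Real.log 4 * x + √x * Real.log x := by field_simp
    _ ≤ 2 * Real.log 4 * x + √x * (2 * √x) := by gcongr
    _ = (2 * Real.log 4 + 2) * x := by
        rw [show √x * (2 * √x) = 2 * (√x * √x) by ring, Real.mul_self_sqrt (by linarith)]; ring
    _ ≤ 5 * x := by gcongr; linarith

lemma le_card_primesLE_mul_log {x : ℝ} (hx : 4 ≤ x) :
    x / 20 ≤ ((⌊x⌋₊.primesLE.card : ℕ) : ℝ) * Real.log x := by
  have h := Chebyshev.pi_ge' (x := x) (by linarith)
  rw [div_le_iff₀ (Real.log_pos (by linarith))] at h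
  rw [Nat.primesLE_card_eq_primeCounting]
  refine le_trans ?_ h
  -- The logarithm lies below its tangent at `x + 2 = 8`; this makes the error term in Chebyshev's
  -- lower bound linear.
  have h1 : Real.log (x + 2) ≤ 3 * Real.log 2 + ((x + 2) / 8 - 1) := by
    rw [show x + 2 = 2 ^ 3 * ((x + 2) / 8) by ring, Real.log_mul (by norm_num) (by linarith),
      Real.log_pow]
    have := Real.log_le_sub_one_of_pos (x := (x + 2) / 8) (by linarith)
    push_cast
    ring_nf at this ⊢
    linarith
  have hl := Real.log_two_gt_d9
  nlinarith

/-! ### Integers free of a set of primes -/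

lemma exists_mul_of_prime_predicate (T : ℕ → Prop) (n : ℕ) (hn : n ≠ 0) :
    ∃ s w : ℕ, n = s * w ∧ (∀ p : ℕ, p.Prime → p ∣ s → T p) ∧
      ∀ p : ℕ, p.Prime → p ∣ w → ¬ T p := by
  induction n using Nat.recOnMul with
  | zero => exact absurd rfl hn
  | one => exact ⟨1, 1, rfl, fun p hp h => absurd h hp.not_dvd_one,
      fun p hp h => absurd h hp.not_dvd_one⟩
  | prime q hq =>
    by_cases h : T q
    · exact ⟨q, 1, by simp, fun p hp hpq => ((Nat.prime_dvd_prime_iff_eq hp hq).1 hpq) ▸ h,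
        fun p hp h => absurd h hp.not_dvd_one⟩
    · exact ⟨1, q, by simp, fun p hp h => absurd h hp.not_dvd_one,
        fun p hp hpq => ((Nat.prime_dvd_prime_iff_eq hp hq).1 hpq) ▸ h⟩
  | mul a b iha ihb =>
    obtain ⟨s, w, h1, h2, h3⟩ := iha (left_ne_zero_of_mul hn)
    obtain ⟨s', w', h1', h2', h3'⟩ := ihb (right_ne_zero_of_mul hn)
    refine ⟨s * s', w * w', by rw [h1, h1']; ring, fun p hp h => ?_, fun p hp h => ?_⟩
    · exact (hp.dvd_mul.1 h).elim (h2 p hp) (h2' p hp)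
    · exact (hp.dvd_mul.1 h).elim (h3 p hp) (h3' p hp)

/-- `m` and `w'` share no prime, so `m` must divide `m'`. Used in both directions, this gives
uniqueness of the splitting into a `T`-free and a `T`-composed factor. -/
lemma dvd_of_mul_eq_mul {T : ℕ → Prop} {m w m' w' : ℕ} (h : m * w = m' * w')
    (hm : ∀ p : ℕ, p.Prime → p ∣ m → ¬ T p) (hw' : ∀ p : ℕ, p.Prime → p ∣ w' → T p) : m ∣ m' := by
  refine Nat.Coprime.dvd_of_dvd_mul_right (Nat.coprime_of_dvd fun p hp h1 h2 => ?_)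
    (h ▸ dvd_mul_right m w)
  exact hm p hp h1 (hw' p hp h2)

/-- The integers in `[1, N]` not divisible by any element of `W`. -/
def freeOf (W : Finset ℕ) (N : ℕ) : Finset ℕ := (Icc 1 N).filter fun n => ∀ p ∈ W, ¬ p ∣ n

lemma mem_freeOf {W : Finset ℕ} {N n : ℕ} :
    n ∈ freeOf W N ↔ (1 ≤ n ∧ n ≤ N) ∧ ∀ p ∈ W, ¬ p ∣ n := by
  simp [freeOf]

/-- The logarithmic-weight argument for mean values of multiplicative functions: write `log n = ∑
Λ(d)` over `d ∣ n`, note that `n / d` is again free of `W`, and sum over `d` with `ψ(N / m) = O(N /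
m)`. Exchanging `log n` for `log N` costs `log (N / n) ≤ N / n`. Counting is thereby reduced to a
sum of reciprocals. -/
lemma card_freeOf_mul_log_le (W : Finset ℕ) {N : ℕ} (hN : 1 ≤ N) :
    ((freeOf W N).card : ℝ) * Real.log N
      ≤ (Real.log 4 + 5) * (N * ∑ m ∈ freeOf W N, (1 : ℝ) / m) := by
  let g : ArithmeticFunction ℝ := ⟨fun n => if n ∈ freeOf W N then 1 else 0, by simp [mem_freeOf]⟩
  have hg : ∀ n, g n = if n ∈ freeOf W N then 1 else 0 := fun n => rfl
  have hg0 : ∀ n, 0 ≤ g n := fun n => by rw [hg]; split_ifs <;> norm_num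
  have h1 : ∑ n ∈ freeOf W N, Real.log n
      ≤ ∑ n ∈ Ioc 0 N, (g * ArithmeticFunction.vonMangoldt) n := by
    calc _ ≤ ∑ n ∈ freeOf W N, (g * ArithmeticFunction.vonMangoldt) n := by
          refine sum_le_sum fun n hn => le_of_eq ?_
          rw [ArithmeticFunction.mul_apply, ← ArithmeticFunction.vonMangoldt_sum,
            Nat.sum_divisorsAntidiagonal' (f := fun x y => g x * ArithmeticFunction.vonMangoldt y)]
          refine sum_congr rfl fun d hd => ?_
          have hdn := Nat.dvd_of_mem_divisors hd
          obtain ⟨⟨hn1, hnN⟩, hnW⟩ := mem_freeOf.1 hn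
          have : n / d ∈ freeOf W N := mem_freeOf.2
            ⟨⟨Nat.div_pos (Nat.le_of_dvd hn1 hdn) (Nat.pos_of_mem_divisors hd),
              (Nat.div_le_self n d).trans hnN⟩,
              fun p hp h => hnW p hp (h.trans (Nat.div_dvd_of_dvd hdn))⟩
          rw [hg, if_pos this, one_mul]
      _ ≤ _ := by
          refine sum_le_sum_of_subset_of_nonneg (fun n hn => ?_) fun n _ _ => ?_
          · have := (mem_freeOf.1 hn).1
            exact mem_Ioc.2 ⟨this.1, this.2⟩
          · rw [ArithmeticFunction.mul_apply]
            exact sum_nonneg fun x _ => mul_nonneg (hg0 _) ArithmeticFunction.vonMangoldt_nonneg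
  have h2 : ∑ n ∈ Ioc 0 N, (g * ArithmeticFunction.vonMangoldt) n
      ≤ (Real.log 4 + 4) * (N * ∑ m ∈ freeOf W N, (1 : ℝ) / m) := by
    rw [ArithmeticFunction.sum_Ioc_mul_eq_sum_sum]
    calc _ ≤ ∑ m ∈ Ioc 0 N, g m * ((Real.log 4 + 4) * (N / m)) := by
          refine sum_le_sum fun m hm => mul_le_mul_of_nonneg_left ?_ (hg0 m)
          have := Chebyshev.psi_le_const_mul_self (x := (N : ℝ) / m) (by positivity)
          rwa [Chebyshev.psi, Nat.floor_div_eq_div] at this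
      _ = ∑ m ∈ freeOf W N, (Real.log 4 + 4) * ((N : ℝ) / m) := by
          simp only [hg, ite_mul, one_mul, zero_mul, ← sum_filter]
          refine sum_congr ?_ fun _ _ => rfl
          ext m; simp [mem_freeOf]; omega
      _ = _ := by rw [mul_sum, mul_sum]; exact sum_congr rfl fun m _ => by ring
  have h3 : ((freeOf W N).card : ℝ) * Real.log N - ∑ n ∈ freeOf W N, Real.log n
      ≤ N * ∑ m ∈ freeOf W N, (1 : ℝ) / m := by
    rw [← nsmul_eq_mul, ← sum_const, ← sum_sub_distrib, mul_sum]
    refine sum_le_sum fun n hn => ?_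
    have hn := (mem_freeOf.1 hn).1
    have hn0 : (0 : ℝ) < n := by exact_mod_cast hn.1
    have hN0 : (0 : ℝ) < N := by exact_mod_cast hN
    rw [← Real.log_div hN0.ne' hn0.ne', mul_one_div]
    exact Real.log_le_self (by positivity)
  linarith

/-- An upper bound sieve: if every prime up to `z` lies in `W` or in `B`, then few integers up to
`N` are free of prime factors from `W`. -/
lemma card_freeOf_mul_log_mul_log_le {W B : Finset ℕ}
    (hB : ∀ p ∈ B, p.Prime) {N z : ℕ} (hN : 1 ≤ N) (hz : 1 ≤ z)
    (hWB : ∀ p : ℕ, p.Prime → p ≤ z → p ∉ W → p ∈ B) :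
    ((freeOf W N).card : ℝ) * Real.log N * Real.log z
      ≤ (Real.log 4 + 5) * N * (1 + Real.log N + Real.log z)
        * Real.exp (2 * ∑ p ∈ B, (1 : ℝ) / p) := by
  classical
  set E := Real.exp (2 * ∑ p ∈ B, (1 : ℝ) / p)
  set Ω := (Icc 1 z).filter fun w => ∀ p : ℕ, p.Prime → p ∣ w → p ∈ W with hΩ
  set Φ := (Icc 1 z).filter fun s => ∀ p : ℕ, p.Prime → p ∣ s → p ∈ B with hΦ
  set σ := ∑ m ∈ freeOf W N, (1 : ℝ) / m with hσ
  have hσ0 : 0 ≤ σ := sum_nonneg fun _ _ => by positivity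
  -- Products of a `W`-free `m ≤ N` and a `W`-composed `w ≤ z` are distinct integers up to `N * z`.
  have h1 : σ * ∑ w ∈ Ω, (1 : ℝ) / w ≤ 1 + Real.log N + Real.log z := by
    have hinj : Set.InjOn (fun x : ℕ × ℕ => x.1 * x.2) (freeOf W N ×ˢ Ω : Finset (ℕ × ℕ)) := by
      rintro ⟨m, w⟩ h ⟨m', w'⟩ h' heq
      simp only [coe_product, Set.mem_prod, mem_coe, mem_freeOf, hΩ, mem_filter, mem_Icc] at h h'
      simp only at heq
      have hmm : m = m' := Nat.dvd_antisymm
        (dvd_of_mul_eq_mul (T := (· ∈ W)) heq (fun p _ hp hpW => h.1.2 p hpW hp) h'.2.2)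
        (dvd_of_mul_eq_mul (T := (· ∈ W)) heq.symm (fun p _ hp hpW => h'.1.2 p hpW hp) h.2.2)
      subst hmm
      exact Prod.ext rfl (Nat.eq_of_mul_eq_mul_left (by omega) heq)
    calc σ * ∑ w ∈ Ω, (1 : ℝ) / w
        = ∑ x ∈ freeOf W N ×ˢ Ω, (1 : ℝ) / ((x.1 * x.2 : ℕ) : ℝ) := by
          rw [hσ, sum_mul_sum, ← sum_product']
          exact sum_congr rfl fun x _ => by push_cast; rw [div_mul_div_comm, one_mul]
      _ = ∑ n ∈ (freeOf W N ×ˢ Ω).image (fun x : ℕ × ℕ => x.1 * x.2), (1 : ℝ) / n :=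
          (sum_image (f := fun n : ℕ => (1 : ℝ) / n) hinj).symm
      _ ≤ ∑ n ∈ Icc 1 (N * z), (1 : ℝ) / n := by
          refine sum_le_sum_of_subset_of_nonneg (fun n hn => ?_) fun _ _ _ => by positivity
          obtain ⟨⟨m, w⟩, h, rfl⟩ := mem_image.1 hn
          simp only [mem_product, mem_freeOf, hΩ, mem_filter, mem_Icc] at h ⊢
          exact ⟨Nat.mul_pos h.1.1.1 h.2.1.1, Nat.mul_le_mul h.1.1.2 h.2.1.2⟩
      _ ≤ 1 + Real.log ((N * z : ℕ) : ℝ) := sum_one_div_Icc_le _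
      _ = _ := by
          push_cast
          rw [Real.log_mul (by positivity) (by positivity)]; ring
  -- Each `n ≤ z` splits into a `W`-part and a `B`-part. This bounds the sum over `Ω` from below,
  -- hence `σ` from above.
  have h2 : Real.log z ≤ (∑ w ∈ Ω, (1 : ℝ) / w) * E := by
    calc Real.log z ≤ ∑ n ∈ Icc 1 z, (1 : ℝ) / n := log_le_sum_one_div_Icc hz
      _ ≤ ∑ n ∈ (Ω ×ˢ Φ).image (fun x : ℕ × ℕ => x.1 * x.2), (1 : ℝ) / n := by
          refine sum_le_sum_of_subset_of_nonneg (fun n hn => ?_) fun _ _ _ => by positivity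
          rw [mem_Icc] at hn
          obtain ⟨w, s, hws, hw, hs⟩ := exists_mul_of_prime_predicate (· ∈ W) n (by omega)
          have hw0 : 0 < w := Nat.pos_of_ne_zero fun h => by simp [h] at hws; omega
          have hs0 : 0 < s := Nat.pos_of_ne_zero fun h => by simp [h] at hws; omega
          have hwn : w ≤ z := (Nat.le_of_dvd (by omega) ⟨s, hws⟩).trans hn.2
          have hsn : s ≤ z := (Nat.le_of_dvd (by omega) ⟨w, by rw [hws, mul_comm]⟩).trans hn.2
          refine mem_image.2 ⟨(w, s), ?_, hws.symm⟩
          simp only [mem_product, hΩ, hΦ, mem_filter, mem_Icc]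
          exact ⟨⟨⟨hw0, hwn⟩, hw⟩, ⟨hs0, hsn⟩, fun p hp hps =>
            hWB p hp ((Nat.le_of_dvd hs0 hps).trans hsn) (hs p hp hps)⟩
      _ ≤ ∑ x ∈ Ω ×ˢ Φ, (1 : ℝ) / ((x.1 * x.2 : ℕ) : ℝ) :=
          sum_image_le_of_nonneg (g := fun x : ℕ × ℕ => x.1 * x.2)
            (f := fun n : ℕ => (1 : ℝ) / n) fun _ _ => by positivity
      _ = (∑ w ∈ Ω, (1 : ℝ) / w) * ∑ s ∈ Φ, (1 : ℝ) / s := by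
          rw [sum_mul_sum, ← sum_product']
          exact sum_congr rfl fun x _ => by push_cast; rw [div_mul_div_comm, one_mul]
      _ ≤ _ := by
          refine mul_le_mul_of_nonneg_left ?_ (sum_nonneg fun _ _ => by positivity)
          refine sum_inv_le_exp_of_primeFactors_subset hB fun n hn => ?_
          simp only [hΦ, mem_filter, mem_Icc] at hn
          exact ⟨by omega, hn.2⟩
  have h3 := card_freeOf_mul_log_le W hN
  have hE : 0 ≤ E := (Real.exp_pos _).le
  have hlz : 0 ≤ Real.log z := Real.log_natCast_nonneg z
  have h4 : 0 ≤ (Real.log 4 + 5) * N := by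
    have := Real.log_nonneg (x := 4) (by norm_num)
    positivity
  calc ((freeOf W N).card : ℝ) * Real.log N * Real.log z
      ≤ (Real.log 4 + 5) * (N * σ) * Real.log z := by gcongr
    _ ≤ (Real.log 4 + 5) * (N * σ) * ((∑ w ∈ Ω, (1 : ℝ) / w) * E) := by
        refine mul_le_mul_of_nonneg_left h2 ?_
        rw [← mul_assoc]; positivity
    _ = (Real.log 4 + 5) * N * (σ * ∑ w ∈ Ω, (1 : ℝ) / w) * E := by ring
    _ ≤ _ := by gcongr

/-! ### The bilinear estimate on geometric blocks -/

/-- Cauchy–Schwarz on `R` produces the factor `R.card`; only afterwards is `m` extended to the full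
interval, where expanding the square gives complete bilinear sums. Thus sparse cofactors keep their
density gain although the hypothesis concerns all `m ≤ M`. -/
lemma norm_sum_sum_sq_le {a b c : ℕ → ℂ} (ha : ∀ n, ‖a n‖ ≤ 1) (hb : ∀ n, ‖b n‖ ≤ 1)
    (hc : ∀ n, ‖c n‖ ≤ 1) {G R : Finset ℕ} {M : ℕ} (hR : R ⊆ Icc 1 M) {B : ℝ} (hB : 0 ≤ B)
    (h : ∀ q₁ ∈ G, ∀ q₂ ∈ G, q₁ ≠ q₂ → ‖bilinearSum a q₁ q₂ M‖ ≤ B) :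
    ‖∑ q ∈ G, ∑ m ∈ R, b q * c m * a (m * q)‖ ^ 2
      ≤ (R.card : ℝ) * ((G.card : ℝ) * M + (G.card : ℝ) ^ 2 * B) := by
  classical
  set T : ℕ → ℂ := fun m => ∑ q ∈ G, b q * a (m * q) with hT
  have h1 : ‖∑ q ∈ G, ∑ m ∈ R, b q * c m * a (m * q)‖ ≤ ∑ m ∈ R, ‖T m‖ := by
    rw [sum_comm]
    refine (norm_sum_le _ _).trans (sum_le_sum fun m _ => ?_)
    rw [show ∑ q ∈ G, b q * c m * a (m * q) = c m * T m by
      rw [hT, mul_sum]; exact sum_congr rfl fun q _ => by ring, norm_mul]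
    exact mul_le_of_le_one_left (norm_nonneg _) (hc m)
  have h2 : (∑ m ∈ R, ‖T m‖) ^ 2 ≤ (R.card : ℝ) * ∑ m ∈ R, ‖T m‖ ^ 2 := sq_sum_le_card_mul_sum_sq
  have h3 : ∑ m ∈ R, ‖T m‖ ^ 2 ≤ ∑ m ∈ Icc 1 M, ‖T m‖ ^ 2 :=
    sum_le_sum_of_subset_of_nonneg hR fun _ _ _ => by positivity
  have h4 : ((∑ m ∈ Icc 1 M, ‖T m‖ ^ 2 : ℝ) : ℂ)
      = ∑ q₁ ∈ G, ∑ q₂ ∈ G, b q₁ * starRingEnd ℂ (b q₂) * bilinearSum a q₁ q₂ M := by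
    push_cast
    calc ∑ m ∈ Icc 1 M, ((‖T m‖ : ℂ)) ^ 2
        = ∑ m ∈ Icc 1 M, ∑ q₁ ∈ G, ∑ q₂ ∈ G, b q₁ * starRingEnd ℂ (b q₂) *
            (a (m * q₁) * starRingEnd ℂ (a (m * q₂))) := by
          refine sum_congr rfl fun m _ => ?_
          rw [← Complex.mul_conj', hT, map_sum, sum_mul_sum]
          refine sum_congr rfl fun q₁ _ => sum_congr rfl fun q₂ _ => ?_
          rw [map_mul]; ring
      _ = _ := by
          rw [sum_comm]
          refine sum_congr rfl fun q₁ _ => ?_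
          rw [sum_comm]
          refine sum_congr rfl fun q₂ _ => ?_
          rw [bilinearSum, mul_sum]
  have h5 : ∑ m ∈ Icc 1 M, ‖T m‖ ^ 2 ≤ (G.card : ℝ) * M + (G.card : ℝ) ^ 2 * B := by
    have h6 : ∑ m ∈ Icc 1 M, ‖T m‖ ^ 2 ≤
        ∑ q₁ ∈ G, ∑ q₂ ∈ G, ((if q₁ = q₂ then (M : ℝ) else 0) + B) := by
      have h7 : ∑ m ∈ Icc 1 M, ‖T m‖ ^ 2 = ‖((∑ m ∈ Icc 1 M, ‖T m‖ ^ 2 : ℝ) : ℂ)‖ := by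
        rw [Complex.norm_real, Real.norm_of_nonneg (sum_nonneg fun _ _ => by positivity)]
      rw [h7, h4]
      refine (norm_sum_le _ _).trans (sum_le_sum fun q₁ hq₁ => ?_)
      refine (norm_sum_le _ _).trans (sum_le_sum fun q₂ hq₂ => ?_)
      have hbb : ‖b q₁ * starRingEnd ℂ (b q₂)‖ ≤ 1 := by
        rw [norm_mul, RCLike.norm_conj]
        exact mul_le_one₀ (hb _) (norm_nonneg _) (hb _)
      rw [norm_mul]
      refine (mul_le_of_le_one_left (norm_nonneg _) hbb).trans ?_
      split_ifs with hq
      · refine le_add_of_le_of_nonneg ?_ hB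
        rw [bilinearSum]
        refine (norm_sum_le _ _).trans ?_
        calc _ ≤ ∑ _n ∈ Icc 1 M, (1 : ℝ) := by
              refine sum_le_sum fun n _ => ?_
              rw [norm_mul, RCLike.norm_conj]
              exact mul_le_one₀ (ha _) (norm_nonneg _) (ha _)
          _ = M := by simp
      · rw [zero_add]; exact h _ hq₁ _ hq₂ hq
    refine h6.trans (le_of_eq ?_)
    simp only [sum_add_distrib, sum_ite_eq, sum_const, nsmul_eq_mul]
    rw [← sum_filter, filter_true_of_mem fun _ h => h]
    simp; ring
  calc _ ≤ (∑ m ∈ R, ‖T m‖) ^ 2 := by gcongr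
    _ ≤ _ := h2.trans (by gcongr; exact h3.trans h5)

/-- With `M ≤ N / X` and `q ≤ 2 * X`, the diagonal is `M * √G.card = O(N / √X)`. Off the diagonal,
`M ≤ 2 * N / q` turns `M * G.card` into a sum of `1 / q`, so that adding the blocks loses only a
Mertens sum. -/
lemma norm_block_le {a b c : ℕ → ℂ} (ha : ∀ n, ‖a n‖ ≤ 1) (hb : ∀ n, ‖b n‖ ≤ 1)
    (hc : ∀ n, ‖c n‖ ≤ 1) {G R : Finset ℕ} {M : ℕ} (hR : R ⊆ Icc 1 M)
    {N X X₀ K η ρ : ℝ} (hN : 0 ≤ N) (hX₀ : 0 < X₀) (hX : X₀ ≤ X) (hM : (M : ℝ) ≤ N / X)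
    (hK : 0 ≤ K) (hη : 0 ≤ η) (hρ : 0 ≤ ρ) (hG : ∀ q ∈ G, 1 ≤ q ∧ (q : ℝ) ≤ 2 * X)
    (hRc : (R.card : ℝ) ≤ ρ * M)
    (h : ∀ q₁ ∈ G, ∀ q₂ ∈ G, q₁ ≠ q₂ → ‖bilinearSum a q₁ q₂ M‖ ≤ K * (M * η ^ 2)) :
    ‖∑ q ∈ G, ∑ m ∈ R, b q * c m * a (m * q)‖
      ≤ √ρ * (2 * N / √X₀ + √K * η * (2 * N * ∑ q ∈ G, (1 : ℝ) / q)) := by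
  have hXp : 0 < X := hX₀.trans_le hX
  have hGc : (G.card : ℝ) ≤ 2 * X := by
    have : G ⊆ Icc 1 ⌊2 * X⌋₊ := fun q hq => mem_Icc.2 ⟨(hG q hq).1, Nat.le_floor (hG q hq).2⟩
    have := card_le_card this
    rw [Nat.card_Icc, Nat.add_sub_cancel] at this
    exact (Nat.cast_le.2 this).trans (Nat.floor_le (by positivity))
  have h1 := norm_sum_sum_sq_le ha hb hc hR (B := K * (M * η ^ 2)) (by positivity) h
  set g := (G.card : ℝ) with hg
  have hg0 : 0 ≤ g := Nat.cast_nonneg _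
  have h2 : ‖∑ q ∈ G, ∑ m ∈ R, b q * c m * a (m * q)‖ ≤ √ρ * (M * √g + √K * η * (M * g)) := by
    refine (pow_le_pow_iff_left₀ (norm_nonneg _) (by positivity) two_ne_zero).1 (h1.trans ?_)
    have hsg := Real.sq_sqrt hg0
    have hsK := Real.sq_sqrt hK
    have hsρ := Real.sq_sqrt hρ
    calc (R.card : ℝ) * (g * M + g ^ 2 * (K * (M * η ^ 2)))
        ≤ ρ * M * (g * M + g ^ 2 * (K * (M * η ^ 2))) := by gcongr
      _ = √ρ ^ 2 * (M ^ 2 * (√g ^ 2 + (√K * η * g) ^ 2)) := by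
          rw [hsρ, hsg, mul_pow, mul_pow, hsK]; ring
      _ ≤ √ρ ^ 2 * (M ^ 2 * (√g + √K * η * g) ^ 2) := by
          gcongr
          have : 0 ≤ √g * (√K * η * g) := by positivity
          nlinarith
      _ = _ := by ring
  have h3 : M * √g ≤ 2 * N / √X₀ := by
    calc M * √g ≤ N / X * √(2 * X) := by gcongr
      _ = √2 * N / √X := by
        rw [Real.sqrt_mul (by norm_num)]
        have : X = √X * √X := (Real.mul_self_sqrt hXp.le).symm
        have h' : 0 < √X := Real.sqrt_pos.2 hXp
        field_simp
        rw [Real.sq_sqrt hXp.le]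
      _ ≤ 2 * N / √X₀ := by
        have : √2 ≤ 2 := by rw [Real.sqrt_le_left (by norm_num)]; norm_num
        gcongr
  have h4 : M * g ≤ 2 * N * ∑ q ∈ G, (1 : ℝ) / q := by
    rw [hg, mul_comm, ← nsmul_eq_mul, ← sum_const, mul_sum]
    refine sum_le_sum fun q hq => hM.trans ?_
    have hq0 : (0 : ℝ) < q := by exact_mod_cast (hG q hq).1
    rw [mul_one_div, div_le_div_iff₀ hXp hq0]
    nlinarith [(hG q hq).2]
  exact h2.trans (by gcongr)

/-! ### Geometric blocks and the lengths attached to them. -/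

/-- The index of the geometric block `[lam ^ j, lam ^ (j + 1))` containing `q`. -/
def blockIndex (lam : ℝ) (q : ℕ) : ℕ := ⌊Real.log q / Real.log lam⌋₊

/-- The common length `⌊N / lam ^ j⌋` used for the block of index `j`. -/
def blockLength (lam : ℝ) (N j : ℕ) : ℕ := ⌊(N : ℝ) / lam ^ j⌋₊

lemma pow_blockIndex_le {lam : ℝ} (hl : 1 < lam) {q : ℕ} (hq : 1 ≤ q) :
    lam ^ blockIndex lam q ≤ q := by
  have hlog := Real.log_pos hl
  have hq0 : (0 : ℝ) < q := by exact_mod_cast hq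
  rw [← Real.log_le_log_iff (by positivity) hq0, Real.log_pow, ← le_div_iff₀ hlog]
  exact Nat.floor_le (div_nonneg (Real.log_natCast_nonneg q) hlog.le)

lemma lt_pow_blockIndex {lam : ℝ} (hl : 1 < lam) {q : ℕ} (hq : 1 ≤ q) :
    (q : ℝ) < lam * lam ^ blockIndex lam q := by
  have hlog := Real.log_pos hl
  have hq0 : (0 : ℝ) < q := by exact_mod_cast hq
  rw [← pow_succ', ← Real.log_lt_log_iff hq0 (by positivity), Real.log_pow, ← div_lt_iff₀ hlog]
  push_cast
  exact Nat.lt_floor_add_one _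

lemma blockIndex_mono {lam : ℝ} (hl : 1 < lam) {q r : ℕ} (hq : 1 ≤ q) (h : q ≤ r) :
    blockIndex lam q ≤ blockIndex lam r := by
  have hlog := Real.log_pos hl
  have hq0 : (0 : ℝ) < q := by exact_mod_cast hq
  have : (q : ℝ) ≤ r := by exact_mod_cast h
  exact Nat.floor_mono (by gcongr)

lemma blockLength_le {lam : ℝ} (hl : 1 < lam) (N j : ℕ) :
    (blockLength lam N j : ℝ) ≤ N / lam ^ j :=
  Nat.floor_le (by positivity)

/-- If `m * q ≤ N` then `m` is at most the length attached to the block of `q`. -/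
lemma le_blockLength {lam : ℝ} (hl : 1 < lam) {N m q : ℕ} (hq : 1 ≤ q) (h : m * q ≤ N) :
    m ≤ blockLength lam N (blockIndex lam q) := by
  refine Nat.le_floor ?_
  rw [le_div_iff₀ (by positivity)]
  calc (m : ℝ) * lam ^ blockIndex lam q ≤ m * q := by gcongr; exact pow_blockIndex_le hl hq
    _ ≤ N := by exact_mod_cast h

lemma mul_le_of_le_blockLength {lam : ℝ} (hl : 1 < lam) {N m q : ℕ} (hq : 1 ≤ q)
    (h : m ≤ blockLength lam N (blockIndex lam q)) : m * q ≤ ⌊lam * N⌋₊ := by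
  refine Nat.le_floor ?_
  have h1 : (m : ℝ) ≤ N / lam ^ blockIndex lam q :=
    (Nat.cast_le.2 h).trans (blockLength_le hl N _)
  push_cast
  calc (m : ℝ) * q ≤ N / lam ^ blockIndex lam q * (lam * lam ^ blockIndex lam q) := by
        gcongr; exact (lt_pow_blockIndex hl hq).le
    _ = lam * N := by field_simp

lemma half_le_log_one_add {δ : ℝ} (h0 : 0 ≤ δ) (h1 : δ ≤ 1) : δ / 2 ≤ Real.log (1 + δ) := by
  have := Real.one_sub_inv_le_log_of_pos (x := 1 + δ) (by linarith)
  refine le_trans ?_ this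
  rw [le_sub_iff_add_le, ← le_sub_iff_add_le', inv_le_iff_one_le_mul₀ (by linarith)]
  nlinarith

lemma card_image_blockIndex_le {δ Z : ℝ} (h0 : 0 < δ) (h1 : δ ≤ 1) (hZ : 0 ≤ Z) {I : Finset ℕ}
    (hI : ∀ q ∈ I, 1 ≤ q ∧ (q : ℝ) ≤ Real.exp Z) :
    ((I.image (blockIndex (1 + δ))).card : ℝ) ≤ 2 * Z / δ + 1 := by
  have hsub : I.image (blockIndex (1 + δ)) ⊆ range (⌊2 * Z / δ⌋₊ + 1) := by
    intro j hj
    obtain ⟨q, hq, rfl⟩ := mem_image.1 hj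
    rw [mem_range, Nat.lt_succ_iff]
    refine Nat.floor_mono ?_
    have hq0 : (0 : ℝ) < q := by exact_mod_cast (hI q hq).1
    have h2 : Real.log q ≤ Z := (Real.log_le_iff_le_exp hq0).2 (hI q hq).2
    calc Real.log q / Real.log (1 + δ) ≤ Z / (δ / 2) := by
          gcongr; exact half_le_log_one_add h0.le h1
      _ = 2 * Z / δ := by field_simp
  have := card_le_card hsub
  rw [card_range] at this
  calc _ ≤ ((⌊2 * Z / δ⌋₊ + 1 : ℕ) : ℝ) := by exact_mod_cast this
    _ ≤ _ := by push_cast; gcongr; exact Nat.floor_le (by positivity)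

/-- The sum of the block estimates. -/
lemma norm_sum_blocks_le {a b c : ℕ → ℂ} (ha : ∀ n, ‖a n‖ ≤ 1) (hb : ∀ n, ‖b n‖ ≤ 1)
    (hc : ∀ n, ‖c n‖ ≤ 1) {lam : ℝ} (hl : 1 < lam) (hl2 : lam ≤ 2) {N : ℕ} {I : Finset ℕ}
    {R : ℕ → Finset ℕ} {X₀ K η ρ : ℝ} (hX₀ : 0 < X₀) (hK : 0 ≤ K) (hη : 0 ≤ η) (hρ : 0 ≤ ρ)
    (hI : ∀ q ∈ I, 1 ≤ q ∧ X₀ ≤ lam ^ blockIndex lam q)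
    (hR : ∀ q ∈ I, R (blockIndex lam q) ⊆ Icc 1 (blockLength lam N (blockIndex lam q)))
    (hRc : ∀ q ∈ I, ((R (blockIndex lam q)).card : ℝ)
      ≤ ρ * blockLength lam N (blockIndex lam q))
    (h : ∀ q₁ ∈ I, ∀ q₂ ∈ I, blockIndex lam q₁ = blockIndex lam q₂ → q₁ ≠ q₂ →
      ‖bilinearSum a q₁ q₂ (blockLength lam N (blockIndex lam q₁))‖
        ≤ K * (blockLength lam N (blockIndex lam q₁) * η ^ 2)) :
    ‖∑ q ∈ I, ∑ m ∈ R (blockIndex lam q), b q * c m * a (m * q)‖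
      ≤ √ρ * ((I.image (blockIndex lam)).card * (2 * N / √X₀)
        + √K * η * (2 * N * ∑ q ∈ I, (1 : ℝ) / q)) := by
  have hmaps : ∀ q ∈ I, blockIndex lam q ∈ I.image (blockIndex lam) :=
    fun q hq => mem_image_of_mem _ hq
  rw [← sum_fiberwise_of_maps_to hmaps, ← sum_fiberwise_of_maps_to hmaps (fun q => (1 : ℝ) / q)]
  calc _ ≤ ∑ j ∈ I.image (blockIndex lam), √ρ * (2 * N / √X₀ + √K * η *
        (2 * N * ∑ q ∈ I with blockIndex lam q = j, (1 : ℝ) / q)) := by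
        refine (norm_sum_le _ _).trans (sum_le_sum fun j hj => ?_)
        obtain ⟨q₀, hq₀, rfl⟩ := mem_image.1 hj
        have heq : ∑ q ∈ I with blockIndex lam q = blockIndex lam q₀,
              ∑ m ∈ R (blockIndex lam q), b q * c m * a (m * q)
            = ∑ q ∈ I with blockIndex lam q = blockIndex lam q₀,
              ∑ m ∈ R (blockIndex lam q₀), b q * c m * a (m * q) :=
          sum_congr rfl fun q hq => by rw [(mem_filter.1 hq).2]
        rw [heq]
        refine norm_block_le ha hb hc (hR q₀ hq₀) (Nat.cast_nonneg N) hX₀ (hI q₀ hq₀).2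
          (blockLength_le hl N _) hK hη hρ (fun q hq => ?_) (hRc q₀ hq₀)
          fun q₁ hq₁ q₂ hq₂ hne => ?_
        · rw [mem_filter] at hq
          refine ⟨(hI q hq.1).1, ?_⟩
          rw [← hq.2]
          refine (lt_pow_blockIndex hl (hI q hq.1).1).le.trans ?_
          gcongr
        · rw [mem_filter] at hq₁ hq₂
          have := h q₁ hq₁.1 q₂ hq₂.1 (hq₁.2.trans hq₂.2.symm) hne
          rwa [hq₁.2] at this
    _ = _ := by
        rw [← mul_sum, sum_add_distrib, sum_const, nsmul_eq_mul, ← mul_sum, ← mul_sum]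

lemma comparable_of_blockIndex_eq {lam : ℝ} (hl : 1 < lam) (hl2 : lam ≤ 2) {q r : ℕ} (hq : 1 ≤ q)
    (hr : 1 ≤ r) (h : blockIndex lam q = blockIndex lam r) (hne : q ≠ r) : Comparable q r := by
  have hr0 : (0 : ℝ) < r := by exact_mod_cast hr
  have h1 := pow_blockIndex_le hl hq
  have h2 := lt_pow_blockIndex hl hq
  have h3 := pow_blockIndex_le hl hr
  have h4 := lt_pow_blockIndex hl hr
  rw [h] at h1 h2
  have hp : 0 < lam ^ blockIndex lam r := by positivity
  refine ⟨hne, ?_, ?_⟩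
  · rw [le_div_iff₀ hr0]; nlinarith
  · rw [div_le_iff₀ hr0]; nlinarith

lemma card_Ioc_floor_le {δ : ℝ} (hδ : 0 ≤ δ) (N : ℕ) :
    ((Ioc N ⌊(1 + δ) * N⌋₊).card : ℝ) ≤ δ * N := by
  have h1 : N ≤ ⌊(1 + δ) * N⌋₊ := Nat.le_floor (by nlinarith [Nat.cast_nonneg (α := ℝ) N])
  rw [Nat.card_Ioc, Nat.cast_sub h1]
  have := Nat.floor_le (a := (1 + δ) * N) (by positivity)
  linarith

/-! ### Counting pairs of primes -/

lemma mem_primePairs {N : ℕ} {r : ℕ × ℕ} :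
    r ∈ primePairs N ↔ r.1.Prime ∧ r.2.Prime ∧ r.1 * r.2 ≤ N := by
  simp only [primePairs, mem_filter, mem_product, mem_range]
  refine ⟨fun h => h.2, fun h => ⟨⟨?_, ?_⟩, h⟩⟩
  · exact Nat.lt_succ_of_le ((Nat.le_mul_of_pos_right _ h.2.1.pos).trans h.2.2)
  · exact Nat.lt_succ_of_le ((Nat.le_mul_of_pos_left _ h.1.pos).trans h.2.2)

lemma primePairs_eq_empty {N : ℕ} (hN : N < 4) : primePairs N = ∅ := by
  refine eq_empty_of_forall_notMem fun r hr => ?_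
  obtain ⟨h1, h2, h3⟩ := mem_primePairs.1 hr
  have := Nat.mul_le_mul h1.two_le h2.two_le
  omega

lemma swap_mem_primePairs {N : ℕ} {r : ℕ × ℕ} (h : r ∈ primePairs N) : r.swap ∈ primePairs N := by
  obtain ⟨h1, h2, h3⟩ := mem_primePairs.1 h
  exact mem_primePairs.2 ⟨h2, h1, by rw [mul_comm]; exact h3⟩

/-- Pairs whose second member lies in a set `E` of primes, as an iterated sum. -/
lemma sum_primePairs_filter_snd {β : Type*} [AddCommMonoid β] (f : ℕ → ℕ → β) {N : ℕ}
    {E : Finset ℕ} (hE : ∀ q ∈ E, q.Prime) :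
    ∑ r ∈ primePairs N with r.2 ∈ E, f r.1 r.2 = ∑ q ∈ E, ∑ p ∈ (N / q).primesLE, f p q := by
  rw [sum_sigma']
  refine sum_nbij' (fun r => ⟨r.2, r.1⟩) (fun s => (s.2, s.1)) ?_ ?_ ?_ ?_ ?_
  · intro r hr
    obtain ⟨h, hq⟩ := mem_filter.1 hr
    obtain ⟨h1, h2, h3⟩ := mem_primePairs.1 h
    exact mem_sigma.2 ⟨hq, Nat.mem_primesLE.2 ⟨(Nat.le_div_iff_mul_le h2.pos).2 h3, h1⟩⟩
  · intro s hs
    obtain ⟨h1, h2⟩ := mem_sigma.1 hs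
    obtain ⟨h3, h4⟩ := Nat.mem_primesLE.1 h2
    exact mem_filter.2 ⟨mem_primePairs.2 ⟨h4, hE _ h1,
      (Nat.le_div_iff_mul_le (hE _ h1).pos).1 h3⟩, h1⟩
  all_goals simp

lemma sum_primePairs_filter_fst (a : ℕ → ℂ) {N : ℕ} (E : Finset ℕ) :
    ∑ r ∈ primePairs N with r.1 ∈ E, a (r.1 * r.2)
      = ∑ r ∈ primePairs N with r.2 ∈ E, a (r.1 * r.2) := by
  refine sum_nbij' Prod.swap Prod.swap ?_ ?_ ?_ ?_ ?_
  · intro r hr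
    obtain ⟨h, hq⟩ := mem_filter.1 hr
    exact mem_filter.2 ⟨swap_mem_primePairs h, hq⟩
  · intro r hr
    obtain ⟨h, hq⟩ := mem_filter.1 hr
    exact mem_filter.2 ⟨swap_mem_primePairs h, hq⟩
  · simp
  · simp
  · intro r _; simp [mul_comm]

lemma card_primePairs_filter_fst {N : ℕ} (E : Finset ℕ) :
    ((primePairs N).filter (fun r => r.1 ∈ E)).card
      = ((primePairs N).filter (fun r => r.2 ∈ E)).card := by
  have := sum_primePairs_filter_fst (fun _ => 1) (N := N) E
  simpa using this

/-- For `q ≤ √N` one has `log (N / q) ≥ (log N) / 2`, so Chebyshev's bound for the number of `p ≤ N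
/ q` is uniform. -/
lemma card_primePairs_filter_snd_le {N : ℕ} (hN : 1 < N) {E : Finset ℕ}
    (hE : ∀ q ∈ E, q.Prime ∧ q ^ 2 ≤ N) :
    (((primePairs N).filter (fun r => r.2 ∈ E)).card : ℝ)
      ≤ 10 * (N / Real.log N) * ∑ q ∈ E, (1 : ℝ) / q := by
  have hN0 : (1 : ℝ) < N := by exact_mod_cast hN
  have hL : 0 < Real.log N := Real.log_pos hN0
  have h := sum_primePairs_filter_snd (fun _ _ => (1 : ℝ)) (N := N) (E := E) fun q hq => (hE q hq).1
  simp only [sum_const, nsmul_eq_mul, mul_one] at h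
  rw [h, mul_sum]
  refine sum_le_sum fun q hq => ?_
  obtain ⟨hqp, hq2⟩ := hE q hq
  have hq1 : (1 : ℝ) < q := by exact_mod_cast hqp.one_lt
  have hq2' : (q : ℝ) ^ 2 ≤ N := by exact_mod_cast hq2
  have hqN : (q : ℝ) ≤ N / q := by
    rw [le_div_iff₀ (by linarith)]; nlinarith
  have h1 := card_primesLE_mul_log_le (x := (N : ℝ) / q) (hq1.trans_le hqN)
  rw [Nat.floor_div_eq_div] at h1
  have h2 : Real.log N / 2 ≤ Real.log ((N : ℝ) / q) := by
    have h3 : Real.log q ≤ Real.log ((N : ℝ) / q) := Real.log_le_log (by linarith) hqN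
    rw [Real.log_div (by linarith) (by linarith)] at h3 ⊢
    linarith
  have h4 : ((N / q).primesLE.card : ℝ) * (Real.log N / 2) ≤ 5 * (N / q) :=
    (mul_le_mul_of_nonneg_left h2 (Nat.cast_nonneg _)).trans h1
  rw [← le_div_iff₀ (by positivity)] at h4
  refine h4.trans (le_of_eq ?_)
  field_simp
  norm_num

/-- Only pairs with second member `q ≤ √N` are kept: Chebyshev gives at least `N / (20 * q * log N)`
choices of `p`, and the sum of `1 / q` is at least `(log log N) / 4`. -/
lemma le_card_primePairs {N : ℕ} (hN : 100 ≤ Real.log N) :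
    N * Real.log (Real.log N) ≤ 80 * Real.log N * (primePairs N).card := by
  set L := Real.log N with hL
  have hN0 : (0 : ℝ) < N := by
    rcases Nat.eq_zero_or_pos N with h | h
    · rw [hL, h, Nat.cast_zero, Real.log_zero] at hN; linarith
    · exact_mod_cast h
  have hNL : (N : ℝ) = Real.exp L := (Real.exp_log hN0).symm
  have hsq : √(N : ℝ) = Real.exp (L / 2) := by
    rw [hNL, Real.exp_half]
  have hN16 : 16 ≤ Real.exp (L / 2) := by
    have := Real.add_one_le_exp (L / 2); linarith
  set s := ⌊Real.exp (L / 2)⌋₊ with hs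
  have hs2 : (s : ℝ) ≤ Real.exp (L / 2) := Nat.floor_le (Real.exp_pos _).le
  have hs1 : Real.exp (L / 2) < s + 1 := Nat.lt_floor_add_one _
  have hs16 : 15 < (s : ℝ) := by linarith
  have hll : Real.log L ≤ 4 * ∑ p ∈ s.primesLE, (1 : ℝ) / p := by
    have h1 := log_log_le_sum_inv_prime (n := s) (by have : 15 < s := by exact_mod_cast hs16
                                                     omega)
    have h2 : L / 4 ≤ Real.log s := by
      rw [Real.le_log_iff_exp_le (by linarith)]
      have h3 : Real.exp (L / 2) = Real.exp (L / 4) * Real.exp (L / 4) := by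
        rw [← Real.exp_add]; ring_nf
      have h4 := Real.add_one_le_exp (L / 4)
      nlinarith
    have h3 : Real.log (L / 4) ≤ Real.log (Real.log s) := Real.log_le_log (by linarith) h2
    have h5 : Real.log L ≤ 2 * Real.log (L / 4) := by
      rw [show 2 * Real.log (L / 4) = Real.log ((L / 4) ^ 2) by rw [Real.log_pow]; norm_num]
      exact Real.log_le_log (by linarith) (by nlinarith)
    linarith
  have hcard : N / (20 * L) * ∑ p ∈ s.primesLE, (1 : ℝ) / p ≤ (primePairs N).card := by
    have h := sum_primePairs_filter_snd (fun _ _ => (1 : ℝ)) (N := N) (E := s.primesLE)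
      fun q hq => Nat.prime_of_mem_primesLE hq
    simp only [sum_const, nsmul_eq_mul, mul_one] at h
    have h2 : (((primePairs N).filter (fun r => r.2 ∈ s.primesLE)).card : ℝ)
        ≤ (primePairs N).card := by exact_mod_cast card_filter_le _ _
    refine le_trans ?_ h2
    rw [h, mul_sum]
    refine sum_le_sum fun q hq => ?_
    obtain ⟨hqs, hqp⟩ := Nat.mem_primesLE.1 hq
    have hq1 : (1 : ℝ) < q := by exact_mod_cast hqp.one_lt
    have hqe : (q : ℝ) ≤ Real.exp (L / 2) := (Nat.cast_le.2 hqs).trans hs2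
    have hNq : Real.exp (L / 2) ≤ N / q := by
      rw [le_div_iff₀ (by linarith), hNL]
      calc Real.exp (L / 2) * q ≤ Real.exp (L / 2) * Real.exp (L / 2) := by gcongr
        _ = Real.exp L := by rw [← Real.exp_add]; ring_nf
    have h1 := le_card_primesLE_mul_log (x := (N : ℝ) / q) (by linarith)
    rw [Nat.floor_div_eq_div] at h1
    have h3 : Real.log ((N : ℝ) / q) ≤ L := by
      rw [Real.log_div (by linarith) (by linarith)]
      have := Real.log_nonneg hq1.le
      linarith
    have h4 : (N : ℝ) / q / 20 ≤ ((N / q).primesLE.card : ℝ) * L :=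
      h1.trans (mul_le_mul_of_nonneg_left h3 (Nat.cast_nonneg _))
    calc N / (20 * L) * (1 / (q : ℝ)) = N / q / 20 / L := by field_simp
      _ ≤ _ := by rwa [div_le_iff₀ (by linarith)]
  have hL0 : 0 < L := by linarith
  have h6 : N * ∑ p ∈ s.primesLE, (1 : ℝ) / p ≤ (primePairs N).card * (20 * L) := by
    rw [← div_le_iff₀ (by positivity)]
    refine le_trans (le_of_eq ?_) hcard
    ring
  calc N * Real.log L ≤ N * (4 * ∑ p ∈ s.primesLE, (1 : ℝ) / p) := by gcongr
    _ = 4 * (N * ∑ p ∈ s.primesLE, (1 : ℝ) / p) := by ring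
    _ ≤ 4 * ((primePairs N).card * (20 * L)) := mul_le_mul_of_nonneg_left h6 (by norm_num)
    _ = _ := by ring

/-- Two ordered pairs of primes have the same product only if they agree up to order. -/
lemma card_le_two_mul_of_primes {D : Finset ((_ : ℕ) × ℕ)} {t : Finset ℕ}
    (hD : ∀ x ∈ D, x.1.Prime ∧ x.2.Prime ∧ x.2 * x.1 ∈ t) : D.card ≤ 2 * t.card := by
  refine card_le_mul_card_image_of_maps_to (f := fun x => x.2 * x.1) (fun x hx => (hD x hx).2.2) 2
    fun n _ => ?_
  rcases (D.filter fun x => x.2 * x.1 = n).eq_empty_or_nonempty with h | ⟨⟨q, p⟩, h⟩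
  · simp [h]
  · refine (card_le_card (t := {⟨q, p⟩, ⟨p, q⟩}) fun x hx => ?_).trans card_le_two
    obtain ⟨q', p'⟩ := x
    simp only [mem_filter] at h hx
    obtain ⟨hq, hp, -⟩ := hD _ h.1
    obtain ⟨hq', hp', -⟩ := hD _ hx.1
    simp only at hq hp hq' hp'
    have heq : p' * q' = p * q := hx.2.trans h.2.symm
    have : q' ∣ p * q := heq ▸ dvd_mul_left q' p'
    simp only [mem_insert, mem_singleton, Sigma.mk.injEq, heq_eq_eq]
    rcases hq'.dvd_mul.1 this with h1 | h1
    · right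
      have h2 := (Nat.prime_dvd_prime_iff_eq hq' hp).1 h1
      subst h2
      rw [mul_comm] at heq
      exact ⟨rfl, Nat.eq_of_mul_eq_mul_left hq'.pos heq⟩
    · left
      have h2 := (Nat.prime_dvd_prime_iff_eq hq' hq).1 h1
      subst h2
      exact ⟨rfl, Nat.eq_of_mul_eq_mul_right hq'.pos heq⟩

/-- Comparison of a sum over pairs in a block decomposition with the sum over all pairs whose
product is at most `N`, when few pairs overshoot `N`. -/
lemma norm_sum_sub_le {g : ℕ → ℕ → ℂ} (hg : ∀ q p, ‖g q p‖ ≤ 1) {I : Finset ℕ}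
    {R R' : ℕ → Finset ℕ} {N : ℕ} (hR : ∀ q ∈ I, (R q).filter (fun p => p * q ≤ N) = R' q) :
    ‖∑ q ∈ I, ∑ p ∈ R q, g q p - ∑ q ∈ I, ∑ p ∈ R' q, g q p‖
      ≤ ((I.sigma R).filter (fun x => ¬ x.2 * x.1 ≤ N)).card := by
  have h1 : ∑ q ∈ I, ∑ p ∈ R' q, g q p
      = ∑ x ∈ (I.sigma R).filter (fun x => x.2 * x.1 ≤ N), g x.1 x.2 := by
    rw [sum_sigma']
    refine sum_congr ?_ fun _ _ => rfl
    ext x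
    simp only [mem_sigma, mem_filter]
    constructor
    · rintro ⟨h, h'⟩
      rw [← hR _ h, mem_filter] at h'
      exact ⟨⟨h, h'.1⟩, h'.2⟩
    · rintro ⟨⟨h, h'⟩, h''⟩
      exact ⟨h, by rw [← hR _ h, mem_filter]; exact ⟨h', h''⟩⟩
  rw [h1, sum_sigma', ← sum_filter_add_sum_filter_not (I.sigma R) (fun x => x.2 * x.1 ≤ N),
    add_sub_cancel_left]
  refine (norm_sum_le _ _).trans ?_
  calc _ ≤ ∑ _x ∈ (I.sigma R).filter (fun x => ¬ x.2 * x.1 ≤ N), (1 : ℝ) :=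
        sum_le_sum fun x _ => hg _ _
    _ = _ := by simp

/-! ### The criterion for products of two primes -/

/-- The size relations between `log N`, `log log N` and `ε` used throughout the argument. -/
structure AdmissibleScale (ε : ℝ) (N : ℕ) : Prop where
  pos : 0 < ε
  lt_half : ε < 1 / 2
  four_le : 4 ≤ N
  log_large : 8000 ≤ Real.log N
  eight_le_loglog : 8 ≤ Real.log (Real.log N)
  four_le_mul : 4 ≤ ε * Real.log (Real.log N)
  lower_exponent : 1000 * Real.log (Real.log N) ≤ Real.log N ^ ε
  exponent_le : Real.log N ^ ε ≤ Real.log N ^ (1 - ε)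
  exponent_mul : Real.log N ^ ε * Real.log N ^ (1 - ε) = Real.log N
  log_exponent : Real.log (Real.log N ^ ε) = ε * Real.log (Real.log N)
  cast_eq : (N : ℝ) = Real.exp (Real.log N)

/-- With `t = log log N` the hypothesis reads `1000 * t < exp (ε * t)`. This forces `ε * t ≥ 4`,
hence `t ≥ 8` as `ε < 1 / 2`, and then `log N ≥ 1000 * t ≥ 8000`. -/
lemma admissibleScale {ε : ℝ} (hε0 : 0 < ε) (hε : ε < 1 / 2) {N : ℕ} (hN : 4 ≤ N)
    (h : Real.log N ^ 1000 < Real.exp (Real.log N ^ ε)) : AdmissibleScale ε N := by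
  set L := Real.log N with hL
  have hL1 : 1.386 ≤ L := by
    have h1 : Real.log 4 ≤ L := Real.log_le_log (by norm_num) (by exact_mod_cast hN)
    have h4 : Real.log 4 = 2 * Real.log 2 := by
      rw [show (4 : ℝ) = 2 ^ 2 by norm_num, Real.log_pow]; norm_num
    have := Real.log_two_gt_d9
    linarith
  have hL0 : 0 < L := by linarith
  set t := Real.log L with ht
  have ht1 : 0.27 ≤ t := by
    have := Real.one_sub_inv_le_log_of_pos hL0
    have h2 : L⁻¹ ≤ 0.73 := by
      rw [inv_le_iff_one_le_mul₀ hL0]; linarith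
    linarith
  have h1 : 1000 * t < L ^ ε := by
    have := Real.log_lt_log (by positivity) h
    rw [Real.log_exp, Real.log_pow] at this
    exact_mod_cast this
  have h2 : L ^ ε = Real.exp (ε * t) := by rw [Real.rpow_def_of_pos hL0, mul_comm]
  -- Otherwise `1000 * t < 2.8 ^ 4 < 62`, against `t ≥ 0.27`.
  have h3 : 4 ≤ ε * t := by
    by_contra! hlt
    have h4 : Real.exp (ε * t) ≤ Real.exp 4 := Real.exp_le_exp.2 hlt.le
    have h5 : Real.exp 4 = Real.exp 1 ^ 4 := by rw [← Real.exp_nat_mul]; norm_num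
    have h6 : Real.exp 1 ^ 4 ≤ 2.8 ^ 4 := by
      gcongr; exact (Real.exp_one_lt_d9.trans (by norm_num)).le
    norm_num at h6
    linarith
  have h8 : 8 ≤ t := by nlinarith
  have hle : L ^ ε ≤ L := by
    calc L ^ ε ≤ L ^ (1 : ℝ) := Real.rpow_le_rpow_of_exponent_le (by linarith) (by linarith)
      _ = L := Real.rpow_one L
  exact
    { pos := hε0
      lt_half := hε
      four_le := hN
      log_large := by rw [← hL]; linarith
      eight_le_loglog := h8
      four_le_mul := h3
      lower_exponent := h1.le
      exponent_le := Real.rpow_le_rpow_of_exponent_le (by linarith) (by linarith)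
      exponent_mul := by
        rw [← Real.rpow_add hL0]; simpa using hL
      log_exponent := Real.log_rpow hL0 ε
      cast_eq := (Real.exp_log (by positivity)).symm }

/-- The part of the window on which the block estimate is applied. -/
def coreWindow (ε : ℝ) (N : ℕ) : Finset ℕ :=
  (⌊Real.exp (Real.log N ^ (1 - ε) / 2)⌋₊.primesLE).filter
    fun q => Real.exp (Real.log N ^ ε) ≤ q

lemma mem_coreWindow {ε : ℝ} {N q : ℕ} : q ∈ coreWindow ε N ↔ q.Prime ∧
    Real.exp (Real.log N ^ ε) ≤ q ∧ (q : ℝ) ≤ Real.exp (Real.log N ^ (1 - ε) / 2) := by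
  rw [coreWindow, mem_filter, Nat.mem_primesLE, Nat.le_floor_iff (Real.exp_pos _).le]
  tauto

/-- Pairs with no member in the core window are rare. -/
lemma card_primePairs_filter_notMem_le {ε : ℝ} {N : ℕ} (h : AdmissibleScale ε N) :
    (((primePairs N).filter (fun r => r.1 ∉ coreWindow ε N ∧ r.2 ∉ coreWindow ε N)).card : ℝ)
      ≤ 28800 * (ε * (primePairs N).card) := by
  have hL := h.log_large
  have ht := h.eight_le_loglog
  have hu := h.four_le_mul
  have hx := h.lower_exponent
  have hxy := h.exponent_le
  have hmul := h.exponent_mul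
  have hlx := h.log_exponent
  have hNe := h.cast_eq
  have hT := le_card_primePairs (N := N) (by linarith)
  have hcore : ∀ q, q ∈ coreWindow ε N ↔ _ := fun q => mem_coreWindow
  set L := Real.log N with hLd
  set t := Real.log L
  set x := L ^ ε
  set y := L ^ (1 - ε)
  set E := (Nat.sqrt N).primesLE.filter (· ∉ coreWindow ε N) with hE
  have hEp : ∀ q ∈ E, q.Prime ∧ q ^ 2 ≤ N := fun q hq => by
    obtain ⟨h1, h2⟩ := Nat.mem_primesLE.1 (mem_filter.1 hq).1
    exact ⟨h2, by rw [sq]; exact Nat.le_sqrt.1 h1⟩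
  have hexp2 : ∀ z : ℝ, 1 ≤ z → 2 ≤ Real.exp z := fun z hz => by
    have := Real.add_one_le_exp z; linarith
  -- Below the core Mertens gives `6 * ε * t + 14`; above it, `6 * ε * t + 8`, since the ratio of
  -- logarithms is `L / y = x = L ^ ε`. The constants fit because `ε * t ≥ 4`.
  have hEsum : ∑ q ∈ E, (1 : ℝ) / q ≤ 18 * (ε * t) := by
    rw [← sum_filter_add_sum_filter_not E (fun q : ℕ => (q : ℝ) < Real.exp x)]
    have h1 := sum_inv_prime_le_log_log (z := Real.exp x) (hexp2 _ (by linarith))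
      (F := E.filter (fun q : ℕ => (q : ℝ) < Real.exp x)) fun p hp =>
        ⟨(hEp p (mem_filter.1 hp).1).1, (mem_filter.1 hp).2.le⟩
    rw [Real.log_exp, hlx] at h1
    have hyL : y ≤ L := by nlinarith
    have hy0 : 0 < y := by linarith
    have h2 := sum_inv_prime_le (y := Real.exp (y / 2)) (z := Real.exp (L / 2))
      (hexp2 _ (by linarith)) (Real.exp_le_exp.2 (by linarith))
      (F := E.filter (fun q : ℕ => ¬ (q : ℝ) < Real.exp x)) fun p hp => by
        obtain ⟨hp1, hp2⟩ := mem_filter.1 hp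
        obtain ⟨hp3, hp4⟩ := hEp p hp1
        refine ⟨hp3, ?_, ?_⟩
        · by_contra! hlt
          exact (mem_filter.1 hp1).2 ((hcore p).2 ⟨hp3, not_lt.1 hp2, hlt.le⟩)
        · refine (pow_le_pow_iff_left₀ (Nat.cast_nonneg _) (Real.exp_pos _).le two_ne_zero).1 ?_
          calc (p : ℝ) ^ 2 ≤ N := by exact_mod_cast hp4
            _ = Real.exp (L / 2) ^ 2 := by
              rw [hNe, ← Real.exp_nat_mul]; congr 1; push_cast; ring
    rw [Real.log_exp, Real.log_exp, show L / 2 / (y / 2) = x by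
      rw [← hmul]; field_simp, hlx] at h2
    linarith
  have hN1 : 1 < N := by have := h.four_le; omega
  have hcard := card_primePairs_filter_snd_le hN1 hEp
  have hsub : (primePairs N).filter (fun r => r.1 ∉ coreWindow ε N ∧ r.2 ∉ coreWindow ε N)
      ⊆ (primePairs N).filter (fun r => r.1 ∈ E) ∪ (primePairs N).filter (fun r => r.2 ∈ E) := by
    intro r hr
    obtain ⟨hr1, hr2, hr3⟩ := mem_filter.1 hr
    obtain ⟨hp1, hp2, hp3⟩ := mem_primePairs.1 hr1
    rcases le_total r.1 r.2 with hle | hle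
    · exact mem_union_left _ (mem_filter.2 ⟨hr1, mem_filter.2 ⟨Nat.mem_primesLE.2
        ⟨Nat.le_sqrt.2 ((Nat.mul_le_mul_left _ hle).trans hp3), hp1⟩, hr2⟩⟩)
    · exact mem_union_right _ (mem_filter.2 ⟨hr1, mem_filter.2 ⟨Nat.mem_primesLE.2
        ⟨Nat.le_sqrt.2 ((Nat.mul_le_mul_right _ hle).trans hp3), hp2⟩, hr3⟩⟩)
  have hle := (card_le_card hsub).trans (card_union_le _ _)
  rw [card_primePairs_filter_fst] at hle
  have hle' : (((primePairs N).filter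
      (fun r => r.1 ∉ coreWindow ε N ∧ r.2 ∉ coreWindow ε N)).card : ℝ)
      ≤ 2 * (((primePairs N).filter (fun r => r.2 ∈ E)).card : ℝ) := by
    rw [two_mul]; exact_mod_cast hle
  have hε := h.pos
  have hL0 : 0 < L := by linarith
  calc _ ≤ 2 * (10 * (N / L) * (18 * (ε * t))) := by
        refine hle'.trans ?_
        gcongr
        exact hcard.trans (mul_le_mul_of_nonneg_left hEsum (by positivity))
    _ = 360 * ε * ((N * t) / L) := by ring
    _ ≤ 360 * ε * (80 * (primePairs N).card) := by
        refine mul_le_mul_of_nonneg_left ?_ (by positivity)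
        rw [div_le_iff₀ hL0]; linarith
    _ = _ := by ring

/-- Pairs with both members in the core window have negligible product. -/
lemma card_primePairs_filter_mem_le {ε : ℝ} {N : ℕ} (h : AdmissibleScale ε N) :
    (((primePairs N).filter (fun r => r.1 ∈ coreWindow ε N ∧ r.2 ∈ coreWindow ε N)).card : ℝ)
      ≤ N / Real.log N ^ 50 := by
  have hL := h.log_large
  have ht := h.eight_le_loglog
  have hx := h.lower_exponent
  have hxy := h.exponent_le
  have hmul := h.exponent_mul
  have hNe := h.cast_eq
  have hcore : ∀ q, q ∈ coreWindow ε N ↔ _ := fun q => mem_coreWindow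
  set L := Real.log N with hLd
  set t := Real.log L with htd
  set x := L ^ ε
  set y := L ^ (1 - ε)
  have hL0 : 0 < L := by linarith
  have hsub : (primePairs N).filter (fun r => r.1 ∈ coreWindow ε N ∧ r.2 ∈ coreWindow ε N)
      ⊆ Icc 1 ⌊Real.exp (y / 2)⌋₊ ×ˢ Icc 1 ⌊Real.exp (y / 2)⌋₊ := by
    intro r hr
    obtain ⟨-, h1, h2⟩ := mem_filter.1 hr
    rw [hcore] at h1 h2
    exact mem_product.2 ⟨mem_Icc.2 ⟨h1.1.pos, Nat.le_floor h1.2.2⟩,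
      mem_Icc.2 ⟨h2.1.pos, Nat.le_floor h2.2.2⟩⟩
  have hc := card_le_card hsub
  rw [card_product, Nat.card_Icc, Nat.add_sub_cancel] at hc
  have hfl := Nat.floor_le (Real.exp_pos (y / 2)).le
  have h50 : L ^ 50 = Real.exp (50 * t) := by
    rw [htd, ← Real.exp_log (pow_pos hL0 50), Real.log_pow]; norm_num
  calc _ ≤ (⌊Real.exp (y / 2)⌋₊ : ℝ) * ⌊Real.exp (y / 2)⌋₊ := by exact_mod_cast hc
    _ ≤ Real.exp (y / 2) * Real.exp (y / 2) := by gcongr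
    _ = Real.exp y := by rw [← Real.exp_add]; ring_nf
    _ ≤ Real.exp (L - 50 * t) := by
        refine Real.exp_le_exp.2 ?_
        nlinarith
    _ = _ := by rw [Real.exp_sub, ← hNe, h50]

/-- The lengths attached to the blocks of the core window are admissible. -/
lemma blockLength_admissible {ε : ℝ} {N : ℕ} (h : AdmissibleScale ε N) {lam : ℝ} (hl : 1 < lam)
    {q : ℕ} (hq : q ∈ coreWindow ε N) :
    let M := blockLength lam N (blockIndex lam q)
    2 ≤ M ∧ (N : ℝ) ^ (9 / 10 : ℝ) ≤ M ∧ M ≤ N ∧ Real.log N / 2 ≤ Real.log M ∧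
      q ∈ primeWindow ε M := by
  intro M
  obtain ⟨hqp, hq1, hq2⟩ := mem_coreWindow.1 hq
  have hL := h.log_large
  have ht := h.eight_le_loglog
  have hx := h.lower_exponent
  have hxy := h.exponent_le
  have hmul := h.exponent_mul
  have hNe := h.cast_eq
  have hε0 := h.pos
  have hε1 := h.lt_half
  -- This is why the upper exponent of the core is halved: `q` stays in the window of every `M` with
  -- `log M ≥ (log N) / 2`.
  have hy2 : Real.log N ^ (1 - ε) / 2 ≤ (Real.log N / 2) ^ (1 - ε) := by
    rw [Real.div_rpow (by linarith) (by norm_num)]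
    have h2 : (2 : ℝ) ^ (1 - ε) ≤ 2 := by
      calc (2 : ℝ) ^ (1 - ε) ≤ 2 ^ (1 : ℝ) :=
            Real.rpow_le_rpow_of_exponent_le (by norm_num) (by linarith)
        _ = 2 := Real.rpow_one 2
    have : 0 ≤ Real.log N ^ (1 - ε) := Real.rpow_nonneg (by linarith) _
    gcongr
  have hN9 : (N : ℝ) ^ (9 / 10 : ℝ) = Real.exp (9 / 10 * Real.log N) := by
    rw [Real.rpow_def_of_pos (by rw [hNe]; exact Real.exp_pos _), mul_comm]
  rw [primeWindow, Set.mem_ofPred_eq, hN9]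
  set L := Real.log N with hLd
  set x := L ^ ε
  set y := L ^ (1 - ε)
  have hq0 : (0 : ℝ) < q := by exact_mod_cast hqp.pos
  have hyL : 8000 * y ≤ L := by nlinarith
  have hM1 : Real.exp (9 / 10 * L) ≤ M := by
    have h1 : (N : ℝ) / lam ^ blockIndex lam q < M + 1 := Nat.lt_floor_add_one _
    have h2 : (N : ℝ) / q ≤ N / lam ^ blockIndex lam q := by
      gcongr; exact pow_blockIndex_le hl hqp.one_le
    have h3 : Real.exp (L - y / 2) ≤ N / q := by
      rw [Real.exp_sub, ← hNe]; gcongr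
    have h4 : Real.exp (9 / 10 * L) * 2 ≤ Real.exp (L - y / 2) := by
      have : Real.exp (L - y / 2) = Real.exp (9 / 10 * L) * Real.exp (L / 10 - y / 2) := by
        rw [← Real.exp_add]; ring_nf
      rw [this]
      gcongr
      have := Real.add_one_le_exp (L / 10 - y / 2)
      linarith
    have h5 : 1 ≤ Real.exp (9 / 10 * L) := Real.one_le_exp (by linarith)
    linarith
  have hM2 : 2 ≤ M := by
    have := Real.add_one_le_exp (9 / 10 * L)
    have : (2 : ℝ) ≤ M := by linarith
    exact_mod_cast this
  have hM0 : (0 : ℝ) < M := by exact_mod_cast (by omega : 0 < M)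
  have hMN : M ≤ N := by
    have h1 : (M : ℝ) ≤ N / lam ^ blockIndex lam q := blockLength_le hl N _
    have : (M : ℝ) ≤ N := h1.trans (div_le_self (Nat.cast_nonneg _) (one_le_pow₀ hl.le))
    exact_mod_cast this
  have hlM : L / 2 ≤ Real.log M := by
    have : 9 / 10 * L ≤ Real.log M := (Real.le_log_iff_exp_le hM0).2 hM1
    linarith
  have hlM' : Real.log M ≤ L := Real.log_le_log hM0 (by exact_mod_cast hMN)
  refine ⟨hM2, hM1, hMN, hlM, hqp, ?_, ?_⟩
  · refine le_trans (Real.exp_le_exp.2 ?_) hq1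
    exact Real.rpow_le_rpow (by linarith) hlM' hε0.le
  · refine hq2.trans (Real.exp_le_exp.2 (hy2.trans ?_))
    exact Real.rpow_le_rpow (by linarith) hlM (by linarith)

lemma card_primesLE_blockLength_le {ε : ℝ} {N : ℕ} (h : AdmissibleScale ε N) {lam : ℝ}
    (hl : 1 < lam) {q : ℕ} (hq : q ∈ coreWindow ε N) :
    ((blockLength lam N (blockIndex lam q)).primesLE.card : ℝ)
      ≤ 10 / Real.log N * blockLength lam N (blockIndex lam q) := by
  obtain ⟨hM2, -, -, hlM, -⟩ := blockLength_admissible h hl hq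
  set M := blockLength lam N (blockIndex lam q)
  have hL := h.log_large
  have h1 := card_primesLE_mul_log_le (x := M) (by exact_mod_cast (by omega : 1 < M))
  rw [Nat.floor_natCast] at h1
  rw [div_mul_eq_mul_div, le_div_iff₀ (by linarith)]
  have h2 : (M.primesLE.card : ℝ) * (Real.log N / 2) ≤ M.primesLE.card * Real.log M := by gcongr
  linarith

/-- The contribution of the exceptional primes of the blocks. -/
lemma sum_exceptional_le {ε : ℝ} {N : ℕ} (h : AdmissibleScale ε N) {lam : ℝ} (hl : 1 < lam)
    (hl2 : lam ≤ 2) {K : ℝ} (hK : 0 < K) {S : ℕ → Set ℕ}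
    (hS : ∀ M : ℕ, 2 ≤ M → (N : ℝ) ^ (9 / 10 : ℝ) ≤ M → M ≤ N → MostPrimes K ε M (S M))
    {I : Finset ℕ} (hI : I ⊆ coreWindow ε N)
    (hIS : ∀ q ∈ I, q ∉ S (blockLength lam N (blockIndex lam q))) :
    ∑ q ∈ I, ((blockLength lam N (blockIndex lam q)).primesLE.card : ℝ)
      ≤ (I.image (blockIndex lam)).card * (10 / Real.log N * N * (K * (2 / Real.log N) ^ 100)) := by
  have hL := h.log_large
  rw [← sum_fiberwise_of_maps_to (fun q hq => mem_image_of_mem (blockIndex lam) hq),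
    ← nsmul_eq_mul, ← sum_const]
  refine sum_le_sum fun j hj => ?_
  obtain ⟨q₀, hq₀, rfl⟩ := mem_image.1 hj
  have hR := card_primesLE_blockLength_le h hl (hI hq₀)
  obtain ⟨hM2, hM9, hMN, hlM, -⟩ := blockLength_admissible h hl (hI hq₀)
  have hMle := blockLength_le hl N (blockIndex lam q₀)
  have hcongr : ∑ q ∈ I with blockIndex lam q = blockIndex lam q₀,
        ((blockLength lam N (blockIndex lam q)).primesLE.card : ℝ)
      = ∑ q ∈ I with blockIndex lam q = blockIndex lam q₀,
        ((blockLength lam N (blockIndex lam q₀)).primesLE.card : ℝ) :=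
    sum_congr rfl fun q hq => by rw [(mem_filter.1 hq).2]
  rw [hcongr, sum_const, nsmul_eq_mul]
  set M := blockLength lam N (blockIndex lam q₀)
  set X := lam ^ blockIndex lam q₀ with hX
  have hX1 : 1 ≤ X := one_le_pow₀ hl.le
  -- The block lies in `[X, 2 * X]`, so the exceptional-set hypothesis applies with `P = X`; this
  -- `X` cancels against the length `N / X`.
  have hB : ((I.filter (fun q => blockIndex lam q = blockIndex lam q₀)).card : ℝ)
      ≤ K * (X / Real.log M ^ 100) := by
    refine le_trans ?_ ((hS M hM2 hM9 hMN).2 X hX1)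
    rw [← Set.ncard_coe_finset]
    refine Nat.cast_le.2 (Set.ncard_le_ncard ?_ ?_)
    · intro q hq
      obtain ⟨hqI, hqj⟩ := mem_filter.1 (mem_coe.1 hq)
      have hw := (blockLength_admissible h hl (hI hqI)).2.2.2.2
      have hns := hIS q hqI
      have hp := (mem_coreWindow.1 (hI hqI)).1
      have h1 := pow_blockIndex_le hl hp.one_le
      have h2 := lt_pow_blockIndex hl hp.one_le
      rw [hqj] at hw hns h1 h2
      exact ⟨hw, hns, h1, h2.le.trans (by gcongr)⟩
    · refine (Set.finite_Iic ⌊2 * X⌋₊).subset fun q hq => ?_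
      exact Nat.le_floor hq.2.2.2
  have hlM0 : 0 < Real.log M := by linarith
  have hpow : 1 / Real.log M ^ 100 ≤ (2 / Real.log N) ^ 100 := by
    rw [← one_div_pow]
    refine pow_le_pow_left₀ (by positivity) ?_ _
    rw [div_le_div_iff₀ hlM0 (by linarith)]; linarith
  calc _ ≤ K * (X / Real.log M ^ 100) * (10 / Real.log N * (N / X)) := by
        refine mul_le_mul hB (hR.trans ?_) (Nat.cast_nonneg _) (by positivity)
        have : 0 < Real.log N := by linarith
        gcongr
    _ = 10 / Real.log N * N * (K * (1 / Real.log M ^ 100)) := by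
        have : 0 < X := by linarith
        field_simp
    _ ≤ _ := by
        have : 0 < Real.log N := by linarith
        gcongr

/-- The sum over pairs whose second member lies in the core window. -/
lemma norm_sum_core_le {ε : ℝ} {N : ℕ} (h : AdmissibleScale ε N) {K : ℝ} (hK : 0 < K)
    {a : ℕ → ℂ} (ha : ∀ n, ‖a n‖ ≤ 1) {S : ℕ → Set ℕ}
    (hS : ∀ M : ℕ, 2 ≤ M → (N : ℝ) ^ (9 / 10 : ℝ) ≤ M → M ≤ N →
      MostPrimes K ε M (S M) ∧ StrongBilinearBound K a M (S M)) :
    ‖∑ q ∈ coreWindow ε N, ∑ p ∈ (N / q).primesLE, a (p * q)‖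
      ≤ (3 + 2 ^ 57 * √K + 2 ^ 105 * K) * (N / Real.log N ^ 50) := by
  classical
  have hL := h.log_large
  have ht := h.eight_le_loglog
  have hx := h.lower_exponent
  have hxy := h.exponent_le
  have hmul := h.exponent_mul
  have hmem : ∀ q, q ∈ coreWindow ε N ↔ _ := fun q => mem_coreWindow
  set L := Real.log N with hLd
  set t := Real.log L with htd
  set x := L ^ ε
  set y := L ^ (1 - ε)
  have hL0 : 0 < L := by linarith
  have hL1 : 1 ≤ L := by linarith
  have hyL : y ≤ L := by nlinarith
  -- The overshoot is then `O(N / L ^ 50)` and there are at most `2 * L ^ 51` blocks. Exceptional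
  -- primes cost `L ^ 51 * L ^ (-1) * L ^ (-100)`, again `L ^ (-50)`.
  set δ := 1 / L ^ 50 with hδ
  have hδ0 : 0 < δ := by positivity
  have hδ1 : δ ≤ 1 := by
    rw [hδ, div_le_one (by positivity)]; exact one_le_pow₀ hL1
  set lam := 1 + δ with hlam
  have hl : 1 < lam := by linarith
  have hl2 : lam ≤ 2 := by linarith
  set I := coreWindow ε N with hI
  set R : ℕ → Finset ℕ := fun j => (blockLength lam N j).primesLE with hR
  have hprime : ∀ q ∈ I, q.Prime := fun q hq => ((hmem q).1 hq).1
  -- replacing the hyperbolic condition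
  have hedge : ‖∑ q ∈ I, ∑ p ∈ R (blockIndex lam q), a (p * q)
      - ∑ q ∈ I, ∑ p ∈ (N / q).primesLE, a (p * q)‖ ≤ 2 * (N / L ^ 50) := by
    refine (norm_sum_sub_le (g := fun q p => a (p * q)) (fun _ _ => ha _)
      (R := fun q => R (blockIndex lam q)) (N := N) fun q hq => ?_).trans ?_
    · ext p
      have hq1 := (hprime q hq).pos
      simp only [hR, mem_filter, Nat.mem_primesLE, Nat.le_div_iff_mul_le hq1]
      exact ⟨fun h => ⟨h.2, h.1.2⟩, fun h => ⟨⟨le_blockLength hl hq1 h.1, h.2⟩, h.1⟩⟩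
    -- Overshooting products lie in `(N, lam * N]`, and each integer there arises from at most two
    -- ordered pairs.
    · have h1 := card_le_two_mul_of_primes
        (D := (I.sigma fun q => R (blockIndex lam q)).filter (fun x => ¬ x.2 * x.1 ≤ N))
        (t := Ioc N ⌊lam * N⌋₊) fun s hs => by
          obtain ⟨hs1, hs2⟩ := mem_filter.1 hs
          obtain ⟨hs3, hs4⟩ := mem_sigma.1 hs1
          obtain ⟨hs5, hs6⟩ := Nat.mem_primesLE.1 hs4
          exact ⟨hprime _ hs3, hs6, mem_Ioc.2 ⟨not_le.1 hs2,
            mul_le_of_le_blockLength hl (hprime _ hs3).one_le hs5⟩⟩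
      have h2 := card_Ioc_floor_le hδ0.le N
      calc _ ≤ 2 * ((Ioc N ⌊lam * N⌋₊).card : ℝ) := by exact_mod_cast h1
        _ ≤ 2 * (δ * N) := by gcongr
        _ = _ := by rw [hδ]; ring
  -- number of blocks
  have hIexp : ∀ q ∈ I, 1 ≤ q ∧ (q : ℝ) ≤ Real.exp (y / 2) := fun q hq =>
    ⟨(hprime q hq).one_le, ((hmem q).1 hq).2.2⟩
  have hJ : ∀ I' ⊆ I, ((I'.image (blockIndex lam)).card : ℝ) ≤ 2 * L ^ 51 := fun I' hI' => by
    refine (card_image_blockIndex_le hδ0 hδ1 (by linarith : 0 ≤ y / 2)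
      fun q hq => hIexp q (hI' hq)).trans ?_
    have h1 : 2 * (y / 2) / δ = y * L ^ 50 := by rw [hδ]; field_simp
    have h2 : 1 ≤ L ^ 51 := one_le_pow₀ hL1
    have h3 : y * L ^ 50 ≤ L * L ^ 50 := by gcongr
    rw [h1]
    calc y * L ^ 50 + 1 ≤ L * L ^ 50 + L ^ 51 := add_le_add h3 h2
      _ = 2 * L ^ 51 := by ring
  -- exceptional primes
  set Bad := I.filter (fun q => q ∉ S (blockLength lam N (blockIndex lam q))) with hBad
  set Good := I.filter (fun q => ¬ q ∉ S (blockLength lam N (blockIndex lam q))) with hGood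
  have hbad : ‖∑ q ∈ Bad, ∑ p ∈ R (blockIndex lam q), a (p * q)‖
      ≤ 2 ^ 105 * K * (N / L ^ 50) := by
    have h1 := sum_exceptional_le h hl hl2 hK (fun M h1 h2 h3 => (hS M h1 h2 h3).1)
      (filter_subset _ I : Bad ⊆ I) fun q hq => (mem_filter.1 hq).2
    calc _ ≤ ∑ q ∈ Bad, ((R (blockIndex lam q)).card : ℝ) := by
          refine (norm_sum_le _ _).trans (sum_le_sum fun q _ => ?_)
          refine (norm_sum_le _ _).trans ((sum_le_sum fun p _ => ha _).trans ?_)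
          simp
      _ ≤ _ := h1
      _ ≤ 2 * L ^ 51 * (10 / L * N * (K * (2 / L) ^ 100)) := by
          gcongr
          exact hJ _ (filter_subset _ I)
      _ = (2 * 10 * 2 ^ 100) * K * (N / L ^ 50) := by
          rw [div_pow]; field_simp
      _ ≤ _ := by gcongr; norm_num
  -- the remaining primes
  have hgood : ‖∑ q ∈ Good, ∑ p ∈ R (blockIndex lam q), a (p * q)‖
      ≤ (1 + 2 ^ 57 * √K) * (N / L ^ 50) := by
    have hGI : ∀ q ∈ Good, q ∈ I := fun q hq => (mem_filter.1 hq).1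
    -- Core primes exceed `L ^ 1000`, so `X₀ = L ^ 800` is safe and the diagonal, about `L ^ 51 / L
    -- ^ 400`, is negligible. `η ^ 2 = (2 / L) ^ 100` reflects `log M ≥ L / 2`, and `ρ` is the
    -- density of prime cofactors.
    have h1 := norm_sum_blocks_le ha (b := fun _ => 1) (c := fun _ => 1) (by simp) (by simp)
      hl hl2 (N := N) (I := Good) (R := R) (X₀ := L ^ 800) (K := K) (η := (2 / L) ^ 50)
      (ρ := 10 / L) (by positivity) hK.le (by positivity) (by positivity)
      (fun q hq => by
        have hqI := (hmem q).1 (hGI q hq)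
        refine ⟨hqI.1.one_le, ?_⟩
        have h2 := lt_pow_blockIndex hl hqI.1.one_le
        have h3 : L ^ 1000 ≤ q := by
          refine le_trans ?_ hqI.2.1
          rw [← Real.exp_log (pow_pos hL0 1000), Real.log_pow]
          exact Real.exp_le_exp.2 (by exact_mod_cast hx)
        have h4 : 2 * L ^ 800 ≤ L ^ 1000 := by
          calc 2 * L ^ 800 ≤ L ^ 200 * L ^ 800 := by
                gcongr
                exact le_trans (by linarith) (le_self_pow₀ hL1 (by norm_num))
            _ = L ^ 1000 := by ring
        have h5 : lam * lam ^ blockIndex lam q ≤ 2 * lam ^ blockIndex lam q := by gcongr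
        linarith)
      (fun q hq p hp => by
        obtain ⟨hp1, hp2⟩ := Nat.mem_primesLE.1 hp
        exact mem_Icc.2 ⟨hp2.one_le, hp1⟩)
      (fun q hq => card_primesLE_blockLength_le h hl (hGI q hq))
      (fun q₁ hq₁ q₂ hq₂ hj hne => by
        obtain ⟨hM2, hM9, hMN, hlM, -⟩ := blockLength_admissible h hl (hGI q₁ hq₁)
        have hs₁ := not_not.1 (mem_filter.1 hq₁).2
        have hs₂ := not_not.1 (mem_filter.1 hq₂).2
        rw [← hj] at hs₂
        refine ((hS _ hM2 hM9 hMN).2 q₁ hs₁ q₂ hs₂ (comparable_of_blockIndex_eq hl hl2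
          (hprime _ (hGI _ hq₁)).one_le (hprime _ (hGI _ hq₂)).one_le hj hne)).trans ?_
        rw [← pow_mul, div_eq_mul_one_div (blockLength lam N (blockIndex lam q₁) : ℝ),
          ← one_div_pow]
        have h6 : 1 / Real.log (blockLength lam N (blockIndex lam q₁)) ≤ 2 / L := by
          rw [div_le_div_iff₀ (by linarith) hL0]; linarith
        have h7 : 0 ≤ 1 / Real.log (blockLength lam N (blockIndex lam q₁)) := by
          have : 0 < Real.log (blockLength lam N (blockIndex lam q₁)) := by linarith
          positivity
        gcongr)
    simp only [one_mul] at h1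
    refine h1.trans ?_
    have h2 : √(L ^ 800) = L ^ 400 := by
      rw [show L ^ 800 = (L ^ 400) ^ 2 by ring, Real.sqrt_sq (by positivity)]
    have h3 : ∑ q ∈ Good, (1 : ℝ) / q ≤ 8 * t := by
      have := sum_inv_prime_le_log_log (z := Real.exp L) (F := Good)
        (by have := Real.add_one_le_exp L; linarith) fun q hq =>
          ⟨hprime q (hGI q hq), (hIexp q (hGI q hq)).2.trans (Real.exp_le_exp.2 (by linarith))⟩
      rw [Real.log_exp] at this
      linarith
    have h4 : t ≤ 2 * √L := by
      have := Real.log_le_self (x := √L) (by positivity)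
      rw [Real.log_sqrt hL0.le] at this
      linarith
    have hsL : √L * √L = L := Real.mul_self_sqrt hL0.le
    have hs10 : √(10 / L) ≤ 4 / √L := by
      rw [Real.sqrt_div (by norm_num)]
      gcongr
      rw [Real.sqrt_le_left (by norm_num)]; norm_num
    have hs1 : √(10 / L) ≤ 1 := by
      rw [Real.sqrt_le_one, div_le_one hL0]; linarith
    have hN0 : (0 : ℝ) ≤ N := Nat.cast_nonneg N
    have hA : √(10 / L) * (((Good.image (blockIndex lam)).card : ℝ) * (2 * N / √(L ^ 800)))
        ≤ N / L ^ 50 := by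
      calc _ ≤ 1 * (2 * L ^ 51 * (2 * N / L ^ 400)) := by
            rw [h2]
            gcongr
            exact hJ _ (filter_subset _ I)
        _ = (4 / L ^ 299) * (N / L ^ 50) := by field_simp; ring
        _ ≤ 1 * (N / L ^ 50) := by
            gcongr
            rw [div_le_one (by positivity)]
            exact le_trans (by linarith) (le_self_pow₀ hL1 (by norm_num))
        _ = _ := one_mul _
    -- The `√L` bounding `log L` cancels against the square root of the prime density, so exactly `L
    -- ^ (-50)` survives.
    have hB : √(10 / L) * (√K * (2 / L) ^ 50 * (2 * N * ∑ q ∈ Good, (1 : ℝ) / q))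
        ≤ 2 ^ 57 * √K * (N / L ^ 50) := by
      calc _ ≤ 4 / √L * (√K * (2 / L) ^ 50 * (2 * N * (8 * (2 * √L)))) := by
            gcongr
            exact h3.trans (by gcongr)
        _ = 2 ^ 57 * √K * (N / L ^ 50) := by
            have : 0 < √L := Real.sqrt_pos.2 hL0
            rw [div_pow]; field_simp; ring
    rw [mul_add]
    linarith
  have hsplit : ∑ q ∈ I, ∑ p ∈ R (blockIndex lam q), a (p * q)
      = ∑ q ∈ Bad, ∑ p ∈ R (blockIndex lam q), a (p * q)
        + ∑ q ∈ Good, ∑ p ∈ R (blockIndex lam q), a (p * q) :=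
    (sum_filter_add_sum_filter_not I _ _).symm
  calc _ = ‖(∑ q ∈ Bad, ∑ p ∈ R (blockIndex lam q), a (p * q)
        + ∑ q ∈ Good, ∑ p ∈ R (blockIndex lam q), a (p * q))
        - (∑ q ∈ I, ∑ p ∈ R (blockIndex lam q), a (p * q)
          - ∑ q ∈ I, ∑ p ∈ (N / q).primesLE, a (p * q))‖ := by
        rw [← hsplit, sub_sub_cancel]
    _ ≤ _ := (norm_sub_le _ _).trans (add_le_add_left (norm_add_le _ _) _)
    _ ≤ _ := by linarith

/-- Inclusion–exclusion over which members are core. For `ε ≥ 1 / 2` the trivial bound suffices, and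
for `ε < 1 / 2` only `1 / ε ^ 53 ≥ 1` is needed. -/
theorem norm_sum_primePairs_le {K : ℝ} (hK : 0 < K) {ε : ℝ} (hε : 0 < ε)
    {a : ℕ → ℂ} (ha : ∀ n, ‖a n‖ ≤ 1) {S : ℕ → Set ℕ} {N : ℕ}
    (hN : Real.log N ^ 1000 < Real.exp (Real.log N ^ ε))
    (hS : ∀ M : ℕ, 2 ≤ M → (N : ℝ) ^ (9 / 10 : ℝ) ≤ M → M ≤ N →
      MostPrimes K ε M (S M) ∧ StrongBilinearBound K a M (S M)) :
    ‖∑ r ∈ primePairs N, a (r.1 * r.2)‖ ≤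
      (28807 + 2 ^ 58 * √K + 2 ^ 106 * K) * (ε * (primePairs N).card +
        1 / ε ^ 53 * (N / Real.log N ^ 50)) := by
  have hY : 0 ≤ N / Real.log N ^ 50 := by
    have := Real.log_natCast_nonneg N
    positivity
  set Y := N / Real.log N ^ 50
  set T := ((primePairs N).card : ℝ)
  have hT : 0 ≤ T := Nat.cast_nonneg _
  set C := 28807 + 2 ^ 58 * √K + 2 ^ 106 * K with hC
  have hK' : 0 ≤ √K := Real.sqrt_nonneg K
  have hcard : ∀ D : Finset (ℕ × ℕ), ‖∑ r ∈ D, a (r.1 * r.2)‖ ≤ D.card := fun D => by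
    refine (norm_sum_le _ _).trans ((sum_le_sum fun r _ => ha _).trans ?_)
    simp
  have hrhs : 0 ≤ C * (ε * T + 1 / ε ^ 53 * Y) := by positivity
  rcases le_or_gt (1 / 2) ε with hε2 | hε2
  · calc _ ≤ T := hcard _
      _ ≤ 2 * (ε * T) := by nlinarith
      _ ≤ C * (ε * T + 1 / ε ^ 53 * Y) := by
        have : (2 : ℝ) ≤ C := by rw [hC]; nlinarith
        have h0 : 0 ≤ 1 / ε ^ 53 * Y := by positivity
        gcongr
        linarith
  rcases lt_or_ge N 4 with hN4 | hN4
  · rw [primePairs_eq_empty hN4] at *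
    simpa using hrhs
  have h := admissibleScale hε hε2 hN4 hN
  set I := coreWindow ε N
  set f : ℕ × ℕ → ℂ := fun r => a (r.1 * r.2)
  have hcore := norm_sum_core_le h hK ha hS
  have hI : ∀ q ∈ I, q.Prime := fun q hq => (mem_coreWindow.1 hq).1
  rw [← sum_primePairs_filter_snd (fun p q => a (p * q)) hI] at hcore
  have hcore' := hcore
  rw [← sum_primePairs_filter_fst] at hcore'
  have hboth := (hcard _).trans (card_primePairs_filter_mem_le h)
  have hneither := (hcard _).trans (card_primePairs_filter_notMem_le h)
  have e1 : ∑ r ∈ primePairs N, f r = ∑ r ∈ primePairs N with r.2 ∈ I, f r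
      + (∑ r ∈ primePairs N with r.1 ∈ I, f r
        - ∑ r ∈ primePairs N with r.1 ∈ I ∧ r.2 ∈ I, f r)
      + ∑ r ∈ primePairs N with r.1 ∉ I ∧ r.2 ∉ I, f r := by
    simp only [sum_filter]
    rw [← sum_sub_distrib, ← sum_add_distrib, ← sum_add_distrib]
    refine sum_congr rfl fun r _ => ?_
    by_cases h1 : r.1 ∈ I <;> by_cases h2 : r.2 ∈ I <;> simp [h1, h2]
  have e2 : ‖∑ r ∈ primePairs N, f r‖ ≤ ‖∑ r ∈ primePairs N with r.2 ∈ I, f r‖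
      + (‖∑ r ∈ primePairs N with r.1 ∈ I, f r‖
        + ‖∑ r ∈ primePairs N with r.1 ∈ I ∧ r.2 ∈ I, f r‖)
      + ‖∑ r ∈ primePairs N with r.1 ∉ I ∧ r.2 ∉ I, f r‖ := by
    rw [e1]
    refine (norm_add_le _ _).trans (add_le_add_left ?_ _)
    exact (norm_add_le _ _).trans (add_le_add_right (norm_sub_le _ _) _)
  have hY1 : Y ≤ 1 / ε ^ 53 * Y := by
    refine le_mul_of_one_le_left hY ?_
    rw [one_le_div (by positivity)]
    exact pow_le_one₀ hε.le (by linarith)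
  have hεT : 0 ≤ ε * T := by positivity
  calc _ ≤ 2 * ((3 + 2 ^ 57 * √K + 2 ^ 105 * K) * Y) + Y + 28800 * (ε * T) := by
        refine e2.trans ?_
        linarith
    _ ≤ C * Y + C * (ε * T) := by
        have h1 : 2 * ((3 + 2 ^ 57 * √K + 2 ^ 105 * K) * Y) + Y ≤ C * Y := by
          rw [hC]; nlinarith
        have h2 : 28800 * (ε * T) ≤ C * (ε * T) := by
          refine mul_le_mul_of_nonneg_right ?_ hεT
          rw [hC]; nlinarith
        linarith
    _ ≤ C * (1 / ε ^ 53 * Y) + C * (ε * T) := by gcongr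
    _ = _ := by ring

/-! ### The criterion for multiplicative weights -/

/-- The cofactors `m`, of length adapted to the block `j`, free of the members of `W` lying in
blocks up to `j`. -/
def blockCofactors (lam : ℝ) (W : Finset ℕ) (N j : ℕ) : Finset ℕ :=
  (Icc 1 (blockLength lam N j)).filter fun m => ∀ p ∈ W, blockIndex lam p ≤ j → ¬ p ∣ m

lemma mem_blockCofactors {lam : ℝ} {W : Finset ℕ} {N j m : ℕ} :
    m ∈ blockCofactors lam W N j ↔ (1 ≤ m ∧ m ≤ blockLength lam N j) ∧
      ∀ p ∈ W, blockIndex lam p ≤ j → ¬ p ∣ m := by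
  simp [blockCofactors]

/-- A factorisation `m * p` with `p` in the lowest block of `W` meeting the integer is unique. -/
lemma injOn_blockCofactors {lam : ℝ} {W : Finset ℕ} (hW : ∀ p ∈ W, p.Prime) (N : ℕ) :
    Set.InjOn (fun x : (_ : ℕ) × ℕ => x.2 * x.1)
      (W.sigma fun p => blockCofactors lam W N (blockIndex lam p)) := by
  rintro ⟨p, m⟩ h ⟨p', m'⟩ h' heq
  obtain ⟨hp, hm⟩ := mem_sigma.1 (mem_coe.1 h)
  obtain ⟨hp', hm'⟩ := mem_sigma.1 (mem_coe.1 h')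
  simp only at hp hm hp' hm' heq
  by_cases hpp : p = p'
  · subst hpp
    have := Nat.eq_of_mul_eq_mul_right (hW p hp).pos heq
    rw [this]
  · exfalso
    have h1 : p ∣ m' := by
      have : p ∣ m' * p' := heq ▸ dvd_mul_left p m
      rcases (hW p hp).dvd_mul.1 this with h | h
      · exact h
      · exact absurd ((Nat.prime_dvd_prime_iff_eq (hW p hp) (hW p' hp')).1 h) hpp
    have h2 : p' ∣ m := by
      have : p' ∣ m * p := heq ▸ dvd_mul_left p' m'
      rcases (hW p' hp').dvd_mul.1 this with h | h
      · exact h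
      · exact absurd ((Nat.prime_dvd_prime_iff_eq (hW p' hp') (hW p hp)).1 h).symm hpp
    rcases le_total (blockIndex lam p) (blockIndex lam p') with hle | hle
    · exact (mem_blockCofactors.1 hm').2 p hp hle h1
    · exact (mem_blockCofactors.1 hm).2 p' hp' hle h2

/-- An integer without such a factorisation is free of `W`, or has two prime factors in one block
of `W`. -/
lemma mem_freeOf_or_exists_dvd {lam : ℝ} (hl : 1 < lam) {W : Finset ℕ} (hW : ∀ p ∈ W, p.Prime)
    {N n : ℕ} (hn1 : 1 ≤ n) (hnN : n ≤ N)
    (hn : ∀ p ∈ W, ∀ m ∈ blockCofactors lam W N (blockIndex lam p), m * p ≠ n) :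
    n ∈ freeOf W N ∨ ∃ p ∈ W, ∃ q ∈ W, blockIndex lam q = blockIndex lam p ∧ p * q ∣ n := by
  classical
  by_cases hfree : ∀ p ∈ W, ¬ p ∣ n
  · exact Or.inl (mem_freeOf.2 ⟨⟨hn1, hnN⟩, hfree⟩)
  · right
    push Not at hfree
    have hne : (W.filter (· ∣ n)).Nonempty := by
      obtain ⟨p, hp, hpn⟩ := hfree
      exact ⟨p, mem_filter.2 ⟨hp, hpn⟩⟩
    -- For the least `p ∈ W` dividing `n`, an obstruction to membership is a `q ∈ W` dividing `m` in
    -- a block not above that of `p`. As `q ≥ p`, it lies in the same block; `q = p` is allowed.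
    obtain ⟨p, hp, hmin⟩ := exists_min_image _ (fun p => p) hne
    obtain ⟨hpW, m, hm⟩ := mem_filter.1 hp
    have hm0 : 1 ≤ m := Nat.one_le_iff_ne_zero.2 fun h => by simp [h] at hm; omega
    have hmp : m * p = n := by rw [hm, mul_comm]
    have hnot : m ∉ blockCofactors lam W N (blockIndex lam p) := fun h => hn p hpW m h hmp
    rw [mem_blockCofactors] at hnot
    push Not at hnot
    obtain ⟨q, hqW, hqj, hqm⟩ := hnot ⟨hm0, le_blockLength hl (hW p hpW).one_le (hmp ▸ hnN)⟩
    have hpq : p ≤ q := hmin q (mem_filter.2 ⟨hqW, hqm.trans ⟨p, hmp.symm⟩⟩)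
    refine ⟨p, hpW, q, hqW, le_antisymm hqj (blockIndex_mono hl (hW p hpW).one_le hpq), ?_⟩
    rw [hm]
    exact Nat.mul_dvd_mul_left p hqm

lemma card_le_of_mem_Ico {X δ : ℝ} (hX : 0 ≤ X) (hδ : 0 ≤ δ) {F : Finset ℕ}
    (hF : ∀ q ∈ F, X ≤ q ∧ (q : ℝ) ≤ (1 + δ) * X) : (F.card : ℝ) ≤ δ * X + 1 := by
  have hsub : F ⊆ Icc ⌈X⌉₊ ⌊(1 + δ) * X⌋₊ := fun q hq =>
    mem_Icc.2 ⟨Nat.ceil_le.2 (hF q hq).1, Nat.le_floor (hF q hq).2⟩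
  have h1 := card_le_card hsub
  rw [Nat.card_Icc] at h1
  rcases F.eq_empty_or_nonempty with h | ⟨q, hq⟩
  · rw [h, card_empty]; push_cast; positivity
  · have h2 := mem_Icc.1 (hsub hq)
    have h3 : F.card + ⌈X⌉₊ ≤ ⌊(1 + δ) * X⌋₊ + 1 := by omega
    have h3' : (F.card : ℝ) + ⌈X⌉₊ ≤ ⌊(1 + δ) * X⌋₊ + 1 := by exact_mod_cast h3
    have h4 := Nat.le_ceil X
    have h5 := Nat.floor_le (a := (1 + δ) * X) (by positivity)
    linarith

/-- Few integers have two prime factors in one block of `W`. -/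
lemma sum_div_mul_le {δ X₀ : ℝ} (hδ : 0 < δ) (hX₀ : 0 < X₀) (hX : 1 / X₀ ≤ δ) {W : Finset ℕ}
    (hW : ∀ p ∈ W, 1 ≤ p ∧ X₀ ≤ (1 + δ) ^ blockIndex (1 + δ) p) (N : ℕ) :
    ∑ p ∈ W, ∑ q ∈ W with blockIndex (1 + δ) q = blockIndex (1 + δ) p, ((N / (p * q) : ℕ) : ℝ)
      ≤ N * (2 * δ * ∑ p ∈ W, (1 : ℝ) / p) := by
  have hl : 1 < 1 + δ := by linarith
  rw [mul_sum, mul_sum]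
  refine sum_le_sum fun p hp => ?_
  set X := (1 + δ) ^ blockIndex (1 + δ) p with hXd
  have hXp : 0 < X := hX₀.trans_le (hW p hp).2
  have hp0 : (0 : ℝ) < p := by exact_mod_cast (hW p hp).1
  have hF : ∀ q ∈ W.filter (fun q => blockIndex (1 + δ) q = blockIndex (1 + δ) p),
      X ≤ q ∧ (q : ℝ) ≤ (1 + δ) * X := fun q hq => by
    obtain ⟨hq1, hq2⟩ := mem_filter.1 hq
    rw [hXd, ← hq2]
    exact ⟨pow_blockIndex_le hl (hW q hq1).1, (lt_pow_blockIndex hl (hW q hq1).1).le⟩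
  have hcard := card_le_of_mem_Ico hXp.le hδ.le hF
  calc _ ≤ ∑ q ∈ W with blockIndex (1 + δ) q = blockIndex (1 + δ) p, (N : ℝ) / (p * X) := by
        refine sum_le_sum fun q hq => ?_
        calc ((N / (p * q) : ℕ) : ℝ) ≤ (N : ℝ) / ((p * q : ℕ) : ℝ) := Nat.cast_div_le
          _ ≤ N / (p * X) := by
            push_cast
            have := (hF q hq).1
            gcongr
    _ ≤ (δ * X + 1) * (N / (p * X)) := by
        rw [sum_const, nsmul_eq_mul]; gcongr
    _ = N * ((δ + 1 / X) * (1 / p)) := by field_simp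
    _ ≤ N * (2 * δ * (1 / p)) := by
        have : 1 / X ≤ 1 / X₀ := one_div_le_one_div_of_le hX₀ (hW p hp).2
        gcongr
        linarith

/-- Passing from a sum over `n ≤ N` to a sum over factorisations `n = m * p`, `p ∈ W`. -/
lemma norm_sum_sub_sum_blockCofactors_le {δ X₀ : ℝ} (hδ : 0 < δ) (hX₀ : 0 < X₀)
    (hX : 1 / X₀ ≤ δ) {W : Finset ℕ}
    (hW : ∀ p ∈ W, p.Prime ∧ X₀ ≤ (1 + δ) ^ blockIndex (1 + δ) p) {N : ℕ}
    {f : ℕ → ℂ} (hf : ∀ n, ‖f n‖ ≤ 1) :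
    ‖∑ n ∈ Icc 1 N, f n‖
      ≤ ‖∑ p ∈ W, ∑ m ∈ blockCofactors (1 + δ) W N (blockIndex (1 + δ) p), f (m * p)‖
        + δ * N + (freeOf W N).card + N * (2 * δ * ∑ p ∈ W, (1 : ℝ) / p) := by
  classical
  set lam := 1 + δ with hlam
  have hl : 1 < lam := by linarith
  have hWp : ∀ p ∈ W, p.Prime := fun p hp => (hW p hp).1
  set R : ℕ → Finset ℕ := fun p => blockCofactors lam W N (blockIndex lam p) with hR
  set R' : ℕ → Finset ℕ := fun p => (R p).filter (fun m => m * p ≤ N) with hR'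
  have hinj := injOn_blockCofactors (lam := lam) hWp N
  -- products exceeding `N`
  have hedge : ‖∑ p ∈ W, ∑ m ∈ R p, f (m * p) - ∑ p ∈ W, ∑ m ∈ R' p, f (m * p)‖ ≤ δ * N := by
    refine (norm_sum_sub_le (g := fun p m => f (m * p)) (fun _ _ => hf _) (N := N)
      fun p _ => rfl).trans ?_
    refine le_trans (Nat.cast_le.2 ?_) (card_Ioc_floor_le hδ.le N)
    refine card_le_card_of_injOn (fun x => x.2 * x.1) (fun x hx => ?_)
      (hinj.mono (coe_subset.2 (filter_subset _ _)))
    obtain ⟨hx1, hx2⟩ := mem_filter.1 hx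
    obtain ⟨hx3, hx4⟩ := mem_sigma.1 hx1
    exact mem_coe.2 (mem_Ioc.2 ⟨not_le.1 hx2, mul_le_of_le_blockLength hl (hWp _ hx3).one_le
      (mem_blockCofactors.1 hx4).1.2⟩)
  -- integers without a factorisation
  set Im := (W.sigma R').image (fun x : (_ : ℕ) × ℕ => x.2 * x.1) with hIm
  have hImsub : Im ⊆ Icc 1 N := fun n hn => by
    obtain ⟨x, hx, rfl⟩ := mem_image.1 hn
    obtain ⟨hx1, hx2⟩ := mem_sigma.1 hx
    obtain ⟨hx3, hx4⟩ := mem_filter.1 hx2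
    exact mem_Icc.2 ⟨Nat.mul_pos (mem_blockCofactors.1 hx3).1.1 (hWp _ hx1).pos, hx4⟩
  have hsumIm : ∑ n ∈ Im, f n = ∑ p ∈ W, ∑ m ∈ R' p, f (m * p) := by
    rw [hIm, sum_image, sum_sigma]
    exact hinj.mono (coe_subset.2 (sigma_mono (fun _ h => h) fun p => filter_subset _ _))
  have hrest : ((Icc 1 N \ Im).card : ℝ)
      ≤ (freeOf W N).card + N * (2 * δ * ∑ p ∈ W, (1 : ℝ) / p) := by
    have hsub : Icc 1 N \ Im ⊆ freeOf W N ∪ W.biUnion fun p =>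
        (W.filter fun q => blockIndex lam q = blockIndex lam p).biUnion fun q =>
          (Ioc 0 N).filter (p * q ∣ ·) := by
      intro n hn
      obtain ⟨hn1, hn2⟩ := mem_sdiff.1 hn
      obtain ⟨hn3, hn4⟩ := mem_Icc.1 hn1
      rcases mem_freeOf_or_exists_dvd hl hWp hn3 hn4 (fun p hp m hm heq => hn2 (mem_image.2
        ⟨⟨p, m⟩, mem_sigma.2 ⟨hp, mem_filter.2 ⟨hm, heq.le.trans hn4⟩⟩, heq⟩)) with h | h
      · exact mem_union_left _ h
      · obtain ⟨p, hp, q, hq, hj, hd⟩ := h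
        exact mem_union_right _ (mem_biUnion.2 ⟨p, hp, mem_biUnion.2
          ⟨q, mem_filter.2 ⟨hq, hj⟩, mem_filter.2 ⟨mem_Ioc.2 ⟨hn3, hn4⟩, hd⟩⟩⟩)
    have h1 := (card_le_card hsub).trans (card_union_le _ _)
    have h2 : (W.biUnion fun p =>
        (W.filter fun q => blockIndex lam q = blockIndex lam p).biUnion fun q =>
          (Ioc 0 N).filter (p * q ∣ ·)).card
        ≤ ∑ p ∈ W, ∑ q ∈ W with blockIndex lam q = blockIndex lam p, N / (p * q) := by
      refine card_biUnion_le.trans (sum_le_sum fun p _ => card_biUnion_le.trans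
        (sum_le_sum fun q _ => ?_))
      rw [Nat.Ioc_filter_dvd_card_eq_div]
    have h3 := sum_div_mul_le hδ hX₀ hX (fun p hp => ⟨(hWp p hp).one_le, (hW p hp).2⟩) N
    calc ((Icc 1 N \ Im).card : ℝ) ≤ (freeOf W N).card + ((∑ p ∈ W,
          ∑ q ∈ W with blockIndex lam q = blockIndex lam p, N / (p * q) : ℕ) : ℝ) := by
          exact_mod_cast h1.trans (Nat.add_le_add_left h2 _)
      _ ≤ _ := by
          push_cast
          exact add_le_add_right h3 _
  have hrestf : ‖∑ n ∈ Icc 1 N \ Im, f n‖ ≤ (Icc 1 N \ Im).card := by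
    refine (norm_sum_le _ _).trans ((sum_le_sum fun n _ => hf n).trans ?_)
    simp
  rw [← sum_sdiff hImsub, hsumIm]
  calc _ ≤ ‖∑ n ∈ Icc 1 N \ Im, f n‖ + ‖∑ p ∈ W, ∑ m ∈ R' p, f (m * p)‖ := norm_add_le _ _
    _ ≤ ‖∑ n ∈ Icc 1 N \ Im, f n‖ + (‖∑ p ∈ W, ∑ m ∈ R p, f (m * p)‖
        + ‖∑ p ∈ W, ∑ m ∈ R p, f (m * p) - ∑ p ∈ W, ∑ m ∈ R' p, f (m * p)‖) := by
        gcongr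
        exact norm_le_norm_add_norm_sub _ _
    _ ≤ _ := by linarith

/-! ### The multiplicative criterion at large scales, with explicit parameters. -/

/-- The size conditions on `l = log log N` under which the estimates below hold. -/
structure LargeScale (l : ℝ) : Prop where
  const_le : 42 * Real.exp 28 ≤ l
  eight_le_log : 8 ≤ Real.log l
  log_pow_le : Real.log l ^ 36 ≤ l
  log_lin_le : 60 * Real.log l + 14 ≤ l
  pow_le_exp : 20 * l ^ 10 ≤ Real.exp l

lemma eventually_largeScale : ∀ᶠ l : ℝ in Filter.atTop, LargeScale l := by
  have h1 := Filter.eventually_ge_atTop (42 * Real.exp 28)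
  have h2 := Real.tendsto_log_atTop.eventually_ge_atTop 8
  have h3 : ∀ᶠ l : ℝ in Filter.atTop, Real.log l ^ 36 ≤ l := by
    have := (Real.isLittleO_pow_log_id_atTop (n := 36)).bound one_pos
    filter_upwards [this, Filter.eventually_ge_atTop 1] with l hl h1
    rw [one_mul, id, Real.norm_of_nonneg (by linarith : 0 ≤ l)] at hl
    exact (le_abs_self _).trans hl
  have h4 : ∀ᶠ l : ℝ in Filter.atTop, 60 * Real.log l + 14 ≤ l := by
    have := Real.isLittleO_log_id_atTop.bound (show (0 : ℝ) < 1 / 120 by norm_num)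
    filter_upwards [this, Filter.eventually_ge_atTop 28] with l hl h1
    rw [id, Real.norm_of_nonneg (by linarith : 0 ≤ l)] at hl
    have := (le_abs_self _).trans hl
    linarith
  have h5 : ∀ᶠ l : ℝ in Filter.atTop, 20 * l ^ 10 ≤ Real.exp l := by
    have := (Real.isLittleO_pow_exp_atTop (n := 10)).bound (show (0 : ℝ) < 1 / 20 by norm_num)
    filter_upwards [this] with l hl
    rw [Real.norm_of_nonneg (Real.exp_pos l).le] at hl
    have := (le_abs_self _).trans hl
    linarith
  filter_upwards [h1, h2, h3, h4, h5] with l h1 h2 h3 h4 h5 using ⟨h1, h2, h3, h4, h5⟩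

/-- The primes of `[exp((log l)^3), exp(l^10)]`. -/
def doublyLogWindow (l : ℝ) : Finset ℕ :=
  (⌊Real.exp (l ^ 10)⌋₊.primesLE).filter fun q => Real.exp (Real.log l ^ 3) ≤ q

lemma mem_doublyLogWindow {l : ℝ} {q : ℕ} : q ∈ doublyLogWindow l ↔ q.Prime ∧
    Real.exp (Real.log l ^ 3) ≤ q ∧ (q : ℝ) ≤ Real.exp (l ^ 10) := by
  rw [doublyLogWindow, mem_filter, Nat.mem_primesLE, Nat.le_floor_iff (Real.exp_pos _).le]
  tauto

/-- The sieve is applied with `z = exp (l ^ 10)`, the primes missing below `z` being those up to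
`exp ((log l) ^ 3)`. Their Euler factor is at most `exp 28 * (log l) ^ 36 ≤ exp 28 * l`, so the
density is at most `42 * exp 28 * l ^ (-9)`, more than enough. -/
lemma card_freeOf_doublyLogWindow_le {l : ℝ} (h : LargeScale l) {N : ℕ} (hN : 1 ≤ N)
    (hl : Real.log N = Real.exp l) :
    ((freeOf (doublyLogWindow l) N).card : ℝ) ≤ N / l ^ 4 := by
  have hc := h.const_le
  have hs := h.eight_le_log
  have hs36 := h.log_pow_le
  have hle := h.pow_le_exp
  have he28 : 1 ≤ Real.exp 28 := Real.one_le_exp (by norm_num)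
  have hl0 : 0 < l := by linarith
  have hl1 : 1 ≤ l := by linarith
  set s := Real.log l
  set z := ⌊Real.exp (l ^ 10)⌋₊ with hz
  have hl10 : 1 ≤ l ^ 10 := one_le_pow₀ hl1
  have hl10' : 40 ≤ l ^ 10 := le_trans (by linarith) (le_self_pow₀ hl1 (by norm_num))
  have hz1 : Real.exp (l ^ 10 / 2) ≤ z := by
    have h1 : Real.exp (l ^ 10) < z + 1 := Nat.lt_floor_add_one _
    have h2 : Real.exp (l ^ 10) = Real.exp (l ^ 10 / 2) * Real.exp (l ^ 10 / 2) := by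
      rw [← Real.exp_add]; ring_nf
    have h3 := Real.add_one_le_exp (l ^ 10 / 2)
    nlinarith
  have hz0 : (0 : ℝ) < z := (Real.exp_pos _).trans_le hz1
  have hlz : l ^ 10 / 2 ≤ Real.log z := (Real.le_log_iff_exp_le hz0).2 hz1
  have hlz' : Real.log z ≤ l ^ 10 :=
    (Real.log_le_iff_le_exp hz0).2 (Nat.floor_le (Real.exp_pos _).le)
  have hs3 : 1 ≤ s ^ 3 := one_le_pow₀ (by linarith)
  have hsieve := card_freeOf_mul_log_mul_log_le (W := doublyLogWindow l)
    (B := ⌊Real.exp (s ^ 3)⌋₊.primesLE) (fun p hp => Nat.prime_of_mem_primesLE hp) (N := N)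
    (z := z) hN (by exact_mod_cast (Nat.cast_pos.1 hz0)) fun p hp hpz hpW => by
      refine Nat.mem_primesLE.2 ⟨Nat.le_floor ?_, hp⟩
      by_contra! hlt
      exact hpW (mem_doublyLogWindow.2 ⟨hp, hlt.le, (Nat.le_floor_iff (Real.exp_pos _).le).1 hpz⟩)
  have hB : Real.exp (2 * ∑ p ∈ ⌊Real.exp (s ^ 3)⌋₊.primesLE, (1 : ℝ) / p)
      ≤ Real.exp 28 * l := by
    have h1 := sum_inv_prime_le_log_log (z := Real.exp (s ^ 3))
      (by have := Real.add_one_le_exp (s ^ 3); linarith) (F := ⌊Real.exp (s ^ 3)⌋₊.primesLE)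
      fun p hp => ⟨Nat.prime_of_mem_primesLE hp,
        (Nat.le_floor_iff (Real.exp_pos _).le).1 (Nat.le_of_mem_primesLE hp)⟩
    rw [Real.log_exp, Real.log_pow] at h1
    push_cast at h1
    calc _ ≤ Real.exp (28 + Real.log (s ^ 36)) := by
          rw [Real.log_pow]
          push_cast
          exact Real.exp_le_exp.2 (by linarith)
      _ = Real.exp 28 * s ^ 36 := by
          rw [Real.exp_add, Real.exp_log (pow_pos (by linarith) _)]
      _ ≤ _ := by gcongr
  have hl4 : Real.log 4 + 5 ≤ 7 := by
    have h4 : Real.log 4 = 2 * Real.log 2 := by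
      rw [show (4 : ℝ) = 2 ^ 2 by norm_num, Real.log_pow]; norm_num
    have := Real.log_two_lt_d9
    linarith
  have hE : 0 < Real.exp l := Real.exp_pos l
  rw [hl] at hsieve
  set c := ((freeOf (doublyLogWindow l) N).card : ℝ)
  have h6 : c * Real.exp l * (l ^ 10 / 2) ≤ 7 * N * (3 * Real.exp l) * (Real.exp 28 * l) := by
    calc c * Real.exp l * (l ^ 10 / 2) ≤ c * Real.exp l * Real.log z := by gcongr
      _ ≤ _ := hsieve
      _ ≤ _ := by gcongr; linarith
  have h7 : c * l ^ 10 ≤ l * (N * l) := by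
    have h8 : Real.exp l * (c * l ^ 10) ≤ Real.exp l * ((42 * Real.exp 28) * (N * l)) := by
      linarith
    refine (le_of_mul_le_mul_left h8 hE).trans ?_
    gcongr
  rw [le_div_iff₀ (by positivity)]
  have h9 : l ^ 6 * (c * l ^ 4) ≤ l ^ 6 * N := by
    calc l ^ 6 * (c * l ^ 4) = c * l ^ 10 := by ring
      _ ≤ l * (N * l) := h7
      _ = l ^ 2 * N := by ring
      _ ≤ l ^ 6 * N := by
        gcongr
        norm_num
  exact le_of_mul_le_mul_left h9 (by positivity)

lemma blockLength_admissible_of_mem_doublyLogWindow {l : ℝ} (h : LargeScale l) {N : ℕ}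
    (hN : 1 ≤ N) (hl : Real.log N = Real.exp l) {lam : ℝ} (hlam : 1 < lam) {q : ℕ}
    (hq : q ∈ doublyLogWindow l) :
    let M := blockLength lam N (blockIndex lam q)
    (N : ℝ) ^ (9 / 10 : ℝ) ≤ M ∧ M ≤ N ∧ l / 2 ≤ Real.log (Real.log M) := by
  intro M
  obtain ⟨hqp, hq1, hq2⟩ := mem_doublyLogWindow.1 hq
  have hc := h.const_le
  have hle := h.pow_le_exp
  have he28 : 1 ≤ Real.exp 28 := Real.one_le_exp (by norm_num)
  have hN0 : (0 : ℝ) < N := by exact_mod_cast hN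
  have hNe : (N : ℝ) = Real.exp (Real.exp l) := by rw [← hl, Real.exp_log hN0]
  have hN9 : (N : ℝ) ^ (9 / 10 : ℝ) = Real.exp (9 / 10 * Real.exp l) := by
    rw [Real.rpow_def_of_pos hN0, mul_comm, hl]
  rw [hN9]
  set L := Real.exp l with hLd
  have hLl : l + 1 ≤ L := Real.add_one_le_exp l
  have hq0 : (0 : ℝ) < q := by exact_mod_cast hqp.pos
  have hM1 : Real.exp (9 / 10 * L) ≤ M := by
    have h1 : (N : ℝ) / lam ^ blockIndex lam q < M + 1 := Nat.lt_floor_add_one _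
    have h2 : (N : ℝ) / q ≤ N / lam ^ blockIndex lam q := by
      gcongr; exact pow_blockIndex_le hlam hqp.one_le
    have h3 : Real.exp (L - l ^ 10) ≤ N / q := by
      rw [Real.exp_sub, ← hNe]; gcongr
    have h4 : Real.exp (9 / 10 * L) * 2 ≤ Real.exp (L - l ^ 10) := by
      have : Real.exp (L - l ^ 10) = Real.exp (9 / 10 * L) * Real.exp (L / 10 - l ^ 10) := by
        rw [← Real.exp_add]; ring_nf
      rw [this]
      gcongr
      have := Real.add_one_le_exp (L / 10 - l ^ 10)
      linarith
    have h5 : 1 ≤ Real.exp (9 / 10 * L) := Real.one_le_exp (by linarith)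
    linarith
  have hM0 : (0 : ℝ) < M := (Real.exp_pos _).trans_le hM1
  have hMN : M ≤ N := by
    have h1 : (M : ℝ) ≤ N / lam ^ blockIndex lam q := blockLength_le hlam N _
    have : (M : ℝ) ≤ N := h1.trans (div_le_self (Nat.cast_nonneg _) (one_le_pow₀ hlam.le))
    exact_mod_cast this
  have hlM : 9 / 10 * L ≤ Real.log M := (Real.le_log_iff_exp_le hM0).2 hM1
  refine ⟨hM1, hMN, ?_⟩
  rw [Real.le_log_iff_exp_le (by linarith)]
  have h6 : L = Real.exp (l / 2) * Real.exp (l / 2) := by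
    rw [← Real.exp_add, hLd]; ring_nf
  have h7 := Real.add_one_le_exp (l / 2)
  nlinarith

theorem norm_sum_multiplicative_le {K : ℝ} (hK : 0 < K) {N : ℕ} (hN : 1 ≤ N)
    (h : LargeScale (Real.log (Real.log N))) (hl : Real.log N = Real.exp (Real.log (Real.log N)))
    {a : ℕ → ℂ} (ha : ∀ n, ‖a n‖ ≤ 1) (hweak : WeakBilinearBound K a N)
    {ν : ArithmeticFunction ℂ} (hν : ν.IsMultiplicative) (hν1 : ∀ n, ‖ν n‖ ≤ 1) :
    ‖∑ n ∈ Icc 1 N, ν n * a n‖ ≤ (5 + 64 * √K) * (N / Real.log (Real.log N) ^ 4) := by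
  rw [WeakBilinearBound] at hweak
  set l := Real.log (Real.log N) with hld
  have hc := h.const_le
  have hs := h.eight_le_log
  have hlin := h.log_lin_le
  have he28 : 1 ≤ Real.exp 28 := Real.one_le_exp (by norm_num)
  have hl0 : 0 < l := by linarith
  have hl1 : 1 ≤ l := by linarith
  -- The sum of `1 / p` over `W` is at most `l`, so the repeated-block error `2 * δ * l` is `2 * l ^
  -- (-4)`. There are `O(l ^ 15)` blocks.
  set δ := 1 / l ^ 5 with hδ
  have hδ0 : 0 < δ := by positivity
  have hδ1 : δ ≤ 1 := by
    rw [hδ, div_le_one (by positivity)]; exact one_le_pow₀ hl1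
  have hlam : 1 < 1 + δ := by linarith
  have hlam2 : 1 + δ ≤ 2 := by linarith
  set W := doublyLogWindow l with hWd
  have hmem : ∀ q, q ∈ W ↔ _ := fun q => mem_doublyLogWindow
  have hWp : ∀ q ∈ W, q.Prime := fun q hq => ((hmem q).1 hq).1
  have hN0 : (0 : ℝ) ≤ N := Nat.cast_nonneg N
  have hW0 : ∀ q ∈ W, l ^ 60 ≤ (1 + δ) ^ blockIndex (1 + δ) q := fun q hq => by
    have hqW := (hmem q).1 hq
    have h2 := lt_pow_blockIndex hlam hqW.1.one_le
    have h3 : l ^ 62 ≤ q := by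
      refine le_trans ?_ hqW.2.1
      rw [← Real.exp_log (pow_pos hl0 62), Real.log_pow]
      refine Real.exp_le_exp.2 ?_
      push_cast
      nlinarith [mul_self_nonneg (Real.log l - 8)]
    have h4 : 2 * l ^ 60 ≤ l ^ 62 := by
      calc 2 * l ^ 60 ≤ l ^ 2 * l ^ 60 := by
            gcongr
            exact le_trans (by linarith) (le_self_pow₀ hl1 (by norm_num))
        _ = l ^ 62 := by ring
    have h5 : (1 + δ) * (1 + δ) ^ blockIndex (1 + δ) q ≤ 2 * (1 + δ) ^ blockIndex (1 + δ) q := by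
      gcongr
    linarith
  have hWsum : ∑ p ∈ W, (1 : ℝ) / p ≤ l := by
    have hl10 : 1 ≤ l ^ 10 := one_le_pow₀ hl1
    have := sum_inv_prime_le_log_log (z := Real.exp (l ^ 10)) (F := W)
      (by have := Real.add_one_le_exp (l ^ 10); linarith) fun q hq =>
        ⟨hWp q hq, ((hmem q).1 hq).2.2⟩
    rw [Real.log_exp, Real.log_pow] at this
    push_cast at this
    linarith
  have hfree := card_freeOf_doublyLogWindow_le h hN hl
  have hX : 1 / l ^ 60 ≤ δ := by
    rw [hδ]
    exact one_div_le_one_div_of_le (by positivity) (pow_le_pow_right₀ hl1 (by norm_num))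
  have hf : ∀ n, ‖ν n * a n‖ ≤ 1 := fun n => by
    rw [norm_mul]; exact mul_le_one₀ (hν1 n) (norm_nonneg _) (ha n)
  have hmain := norm_sum_sub_sum_blockCofactors_le (N := N) hδ0 (by positivity : 0 < l ^ 60) hX
    (fun q hq => ⟨hWp q hq, hW0 q hq⟩) hf
  have hmult : ∑ p ∈ W, ∑ m ∈ blockCofactors (1 + δ) W N (blockIndex (1 + δ) p),
        ν (m * p) * a (m * p)
      = ∑ p ∈ W, ∑ m ∈ blockCofactors (1 + δ) W N (blockIndex (1 + δ) p),
        ν p * ν m * a (m * p) := by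
    refine sum_congr rfl fun p hp => sum_congr rfl fun m hm => ?_
    -- The cofactor avoids the block of `p` itself, hence is coprime to `p`.
    have hpm := (mem_blockCofactors.1 hm).2 p hp le_rfl
    rw [hν.map_mul_of_coprime (((hWp p hp).coprime_iff_not_dvd.2 hpm).symm), mul_comm (ν m)]
  -- The cofactors have no useful sparsity, so `ρ = 1`. The off-diagonal saving `η = (2 / l) ^ 5`
  -- loses one power of `l` to the sum of `1 / q`, while `X₀ = l ^ 60` makes the diagonal `O(l ^ (15
  -- - 30))`.
  have hbil := norm_sum_blocks_le ha (b := fun n => ν n) (c := fun n => ν n) hν1 hν1 hlam hlam2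
    (N := N) (I := W) (R := fun j => blockCofactors (1 + δ) W N j) (X₀ := l ^ 60) (K := K)
    (η := (2 / l) ^ 5) (ρ := 1) (by positivity) hK.le (by positivity) zero_le_one
    (fun q hq => ⟨(hWp q hq).one_le, hW0 q hq⟩) (fun q hq => filter_subset _ _)
    (fun q hq => by
      rw [one_mul]
      have := card_filter_le (Icc 1 (blockLength (1 + δ) N (blockIndex (1 + δ) q)))
        fun m => ∀ p ∈ W, blockIndex (1 + δ) p ≤ blockIndex (1 + δ) q → ¬ p ∣ m
      rw [Nat.card_Icc, Nat.add_sub_cancel] at this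
      exact_mod_cast this)
    (fun q₁ hq₁ q₂ hq₂ hj hne => by
      obtain ⟨hM9, hMN, hlM⟩ := blockLength_admissible_of_mem_doublyLogWindow h hN hl hlam hq₁
      have hw₁ := (hmem q₁).1 hq₁
      have hw₂ := (hmem q₂).1 hq₂
      refine (hweak _ hM9 hMN q₁ q₂ hw₁.1 hw₂.1 hw₁.2.1 hw₁.2.2 hw₂.2.1 hw₂.2.2
        (comparable_of_blockIndex_eq hlam hlam2 hw₁.1.one_le hw₂.1.one_le hj hne)).trans ?_
      set M := blockLength (1 + δ) N (blockIndex (1 + δ) q₁)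
      have h7 : 0 < Real.log (Real.log M) := by linarith
      have h6 : 1 / Real.log (Real.log M) ≤ 2 / l := by
        rw [div_le_div_iff₀ h7 hl0]; linarith
      rw [← pow_mul, div_eq_mul_one_div (M : ℝ), ← one_div_pow]
      gcongr)
  have hJ := card_image_blockIndex_le hδ0 hδ1 (by positivity : 0 ≤ l ^ 10) (I := W)
    fun q hq => ⟨(hWp q hq).one_le, ((hmem q).1 hq).2.2⟩
  have hJ' : ((W.image (blockIndex (1 + δ))).card : ℝ) ≤ 3 * l ^ 15 := by
    refine hJ.trans ?_
    have h1 : 2 * l ^ 10 / δ = 2 * l ^ 15 := by rw [hδ]; field_simp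
    have h2 : 1 ≤ l ^ 15 := one_le_pow₀ hl1
    linarith
  have hsq : √(l ^ 60) = l ^ 30 := by
    rw [show l ^ 60 = (l ^ 30) ^ 2 by ring, Real.sqrt_sq (by positivity)]
  have hA : ((W.image (blockIndex (1 + δ))).card : ℝ) * (2 * N / √(l ^ 60)) ≤ N / l ^ 4 := by
    calc _ ≤ 3 * l ^ 15 * (2 * N / l ^ 30) := by rw [hsq]; gcongr
      _ = 6 / l ^ 11 * (N / l ^ 4) := by field_simp; ring
      _ ≤ 1 * (N / l ^ 4) := by
        gcongr
        rw [div_le_one (by positivity)]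
        exact le_trans (by linarith) (le_self_pow₀ hl1 (by norm_num))
      _ = _ := one_mul _
  have hB : √K * (2 / l) ^ 5 * (2 * N * ∑ q ∈ W, (1 : ℝ) / q) ≤ 64 * √K * (N / l ^ 4) := by
    calc _ ≤ √K * (2 / l) ^ 5 * (2 * N * l) := by gcongr
      _ = _ := by rw [div_pow]; field_simp; ring
  rw [Real.sqrt_one, one_mul] at hbil
  rw [hmult] at hmain
  have hδN : δ * N ≤ N / l ^ 4 := by
    rw [hδ, one_div_mul_eq_div]
    gcongr
    norm_num
  have hD : N * (2 * δ * ∑ p ∈ W, (1 : ℝ) / p) ≤ 2 * (N / l ^ 4) := by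
    calc _ ≤ N * (2 * δ * l) := by gcongr
      _ = _ := by rw [hδ]; field_simp
  linarith

end SemiprimeCriterion

end

theorem proposition3p1 :
    (∀ K : ℝ, 0 < K → ∃ C : ℝ, 0 < C ∧
      ∀ (ε : ℝ), 0 < ε → ∀ (a : ℕ → ℂ), (∀ n, ‖a n‖ ≤ 1) → ∀ (S : ℕ → Set ℕ) (N : ℕ), 2 ≤ N →
        Real.log N ^ 1000 < Real.exp (Real.log N ^ ε) →
        (∀ M : ℕ, 2 ≤ M → (N : ℝ) ^ (9 / 10 : ℝ) ≤ M → M ≤ N →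
          SemiprimeCriterion.MostPrimes K ε M (S M) ∧
          SemiprimeCriterion.StrongBilinearBound K a M (S M)) →
        ‖∑ r ∈ SemiprimeCriterion.primePairs N, a (r.1 * r.2)‖ ≤
          C * (ε * (∑ _r ∈ SemiprimeCriterion.primePairs N, (1 : ℝ)) +
            1 / ε ^ 53 * (N / Real.log N ^ 50))) ∧
    (∀ K : ℝ, 0 < K → ∃ (C : ℝ) (N₀ : ℕ), 0 < C ∧
      ∀ (a : ℕ → ℂ), (∀ n, ‖a n‖ ≤ 1) → ∀ N : ℕ, N₀ ≤ N →
        SemiprimeCriterion.WeakBilinearBound K a N →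
        ∀ ν : ArithmeticFunction ℂ, ν.IsMultiplicative → (∀ n, ‖ν n‖ ≤ 1) →
          ‖∑ n ∈ Finset.Icc 1 N, ν n * a n‖ ≤
            C * (N * (Real.log (Real.log N) ^ 4)⁻¹)) := by
  refine ⟨fun K hK => ⟨28807 + 2 ^ 58 * √K + 2 ^ 106 * K, by positivity, ?_⟩, fun K hK => ?_⟩
  · intro ε hε a ha S N _ hNε hS
    have := SemiprimeCriterion.norm_sum_primePairs_le hK hε ha hNε hS
    simpa using this
  · have hlog : Filter.Tendsto (fun N : ℕ => Real.log N) Filter.atTop Filter.atTop :=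
      Real.tendsto_log_atTop.comp tendsto_natCast_atTop_atTop
    have hev := (Real.tendsto_log_atTop.comp hlog).eventually
      SemiprimeCriterion.eventually_largeScale
    obtain ⟨N₀, hN₀⟩ := Filter.eventually_atTop.1
      (hev.and ((hlog.eventually_gt_atTop 0).and (Filter.eventually_ge_atTop 1)))
    refine ⟨5 + 64 * √K, N₀, by positivity, fun a ha N hN hweak ν hν hν1 => ?_⟩
    obtain ⟨h1, h2, h3⟩ := hN₀ N hN
    rw [← div_eq_mul_inv]
    exact SemiprimeCriterion.norm_sum_multiplicative_le hK h3 h1 (Real.exp_log h2).symm ha hweak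
      hν hν1
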